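/- **Setting.** All alphabets are finite and all Hilbert spaces are finite-dimensional. In one round, inputs $x\in\mathcal X$, $y\in\mathcal Y$ and a test bit $t\in\{0,1\}$ are drawn from a distribution $\mathrm P(X=x,Y=y,T=t)$ such that, given $T=0$, the inputs lie in $\mathcal X_K\times\mathcal Y_K$ (key inputs) and, given $T=1$, in $\mathcal X_T\times\mathcal Y_T$ (test inputs). For every $x$, $\{M_{a|x}\}_{a\in\mathcal A_x}$ is a POVM on $Q_A$; for every $y$, $\{N_{b|y}\}_{b\in\mathcal B_y}$ is a POVM on $Q_B$. The test data are $\bar c=f(a,b,x,y,t)$, with $\bar c=\perp$ if and only if $t=0$. For a normalized state $\sigma_{Q_AQ_BE}$ the round outputs $$\mathcal M(\sigma)_{A\bar CXYTE}=\sum_{x,y,t}\mathrm P(X=x,Y=y,T=t)\sum_{a,b}|a,\bar c\rangle\langle a,\bar c|\otimes\operatorname{Tr}_{Q_AQ_B}\big[(M_{a|x}\otimes N_{b|y}\otimes\mathbb 1_E)\,\sigma_{Q_AQ_BE}\big]\otimes|x,y,t\rangle\langle x,y,t|.$$ Write $\mathcal M(\sigma)_{AE|X=x}=\sum_{a\in\mathcal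 A_x}|a\rangle\langle a|\otimes\operatorname{Tr}_{Q_AQ_B}[(M_{a|x}\otimes\mathbb 1_{Q_B}\otimes\mathbb 1_E)\sigma_{Q_AQ_BE}]$, and let $\mathcal M(\sigma)_E$ be the marginal of $\mathcal M(\sigma)$ on $E$. For $\rho,\tau\ge 0$ with $\operatorname{Tr}\rho>0$ and $\alpha\in(1,2)$, the Petz–Rényi divergence is $D_\alpha(\rho\|\tau)=\frac1{\alpha-1}\log_2\frac{\operatorname{Tr}[\rho^\alpha\tau^{1-\alpha}]}{\operatorname{Tr}\rho}$ if $\ker\tau\subseteq\ker\rho$ and $+\infty$ otherwise (negative powers are taken on the support), and $H_\alpha(A|B)_\rho=-D_\alpha(\rho_{AB}\|\mathbb 1_A\otimes\rho_B)$. If $\mathrm P(T=0)>0$, $H_\alpha(A|T=0,XE)_{\mathcal M(\sigma)}$ is $H_\alpha(A|XE)$ of the marginal on $AXE$ of $\mathcal M(\sigma)$ conditioned on $T=0$. **Proposition.** Let $\alpha\in(1,2)$. (i) For every such round with $\mathrm P(T=0)>0$ and every normalized state $\sigma_{Q_AQ_BE}$, $$H_\alpha(A|T=0,XE)_{\mathcal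 M(\sigma)}=\frac1{1-\alpha}\log_2\Big(\sum_{x\in\mathcal X_K}\mathrm P(X=x|T=0)\,\operatorname{Tr}\big[\mathcal M(\sigma)_{AE|X=x}^{\alpha}\cdot\mathbb 1_A\otimes\mathcal M(\sigma)_E^{1-\alpha}\big]\Big).$$ (ii) For every integer $m\ge1$ there exist $t_1,\dots,t_m\in(0,1]$ and $w_1,\dots,w_m>0$, depending only on $\alpha$ and $m$, such that for every such round, every normalized state $\sigma_{Q_AQ_BE}$ and every $x\in\mathcal X_K$, $$\operatorname{Tr}\big[\mathcal M(\sigma)_{AE|X=x}^{\alpha}\cdot\mathbb 1_A\otimes\mathcal M(\sigma)_E^{1-\alpha}\big]\le\sup_{(Z_{a,i}^x)}\sum_{a\in\mathcal A_x}\operatorname{Tr}\Big[\sigma_{Q_AQ_BE}\Big(M_{a|x}\otimes\mathbb 1_{Q_B}\otimes P(Z_{a,1}^x,\dots,Z_{a,m}^x)+\mathbb 1_{Q_AQ_B}\otimes Q(Z_{a,1}^x,\dots,Z_{a,m}^x)\Big)\Big],$$ where the supremum, which is finite, is over all families of linear operators $Z_{a,i}^x$ on the Hilbert space of $E$, and $$P(Z_1,\dots,Z_m)=\mathbb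 1+\frac{\sin(\alpha\pi)}{\pi}\sum_{i=1}^m\frac{w_i}{t_i}\big(\mathbb 1+Z_i+Z_i^\dagger+(1-t_i)Z_i^\dagger Z_i\big),\qquad Q(Z_1,\dots,Z_m)=\frac{\sin(\alpha\pi)}{\pi}\sum_{i=1}^m w_i\,Z_iZ_i^\dagger.$$ -/

import Mathlib

open scoped Kronecker Matrix ComplexOrder

namespace DIRenyi

section Linear

variable {m n : Type*} [Fintype m] [Fintype n]

/-- Partial trace over the first tensor factor. -/
def traceLeft (R : Matrix (m × n) (m × n) ℂ) : Matrix n n ℂ :=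
  fun i j => ∑ k, R (k, i) (k, j)

/-- The projector `|k⟩⟨k|` onto a computational basis vector of a classical register. -/
def ketbra [DecidableEq m] (k : m) : Matrix m m ℂ := Matrix.single k k 1

/-- Normalized states. -/
def IsState (ρ : Matrix n n ℂ) : Prop := ρ.PosSemidef ∧ ρ.trace = 1

/-- The real power `ρ ^ s` of a positive semidefinite matrix, by the functional calculus.
Since `(0 : ℝ) ^ s = 0` for `s ≠ 0`, negative powers are taken on the support
(generalized inverse). -/
noncomputable def mpow [DecidableEq n] (ρ : Matrix n n ℂ) (s : ℝ) : Matrix n n ℂ :=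
  cfc (fun r : ℝ => r ^ s) ρ

/-- The quantity `Tr[ρ ^ α * σ ^ (1 - α)]` (a real number for positive semidefinite
`ρ` and `σ`). -/
noncomputable def petzTrace [DecidableEq n] (α : ℝ) (ρ σ : Matrix n n ℂ) : ℝ :=
  (mpow ρ α * mpow σ (1 - α)).trace.re

/-- `ρ ≪ σ`: the kernel of `σ` is contained in the kernel of `ρ`. -/
def Dominated (ρ σ : Matrix n n ℂ) : Prop := ∀ v : n → ℂ, σ *ᵥ v = 0 → ρ *ᵥ v = 0

/-- `ρ ⊥ σ`: orthogonality of operators. -/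
def Orthogonal (ρ σ : Matrix n n ℂ) : Prop := ρ * σ = 0 ∧ σ * ρ = 0

open Classical in
/-- The Petz–Rényi divergence (base `2`), with values in the extended reals. -/
noncomputable def petzDivergence [DecidableEq n] (α : ℝ) (ρ σ : Matrix n n ℂ) : EReal :=
  if (α < 1 ∧ ¬ Orthogonal ρ σ) ∨ Dominated ρ σ then
    ((1 / (α - 1) * Real.logb 2 (petzTrace α ρ σ / ρ.trace.re) : ℝ) : EReal)
  else ⊤

/-- The Petz–Rényi conditional entropy `H_α(A|B) = - D_α(ρ_AB ‖ 1_A ⊗ ρ_B)`. -/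
noncomputable def petzCondEntropy [DecidableEq m] [DecidableEq n] (α : ℝ)
    (ρ : Matrix (m × n) (m × n) ℂ) : EReal :=
  - petzDivergence α ρ ((1 : Matrix m m ℂ) ⊗ₖ traceLeft ρ)

/-- The partial state `ρ_{Q ∧ c}` of a state that is classical on its first register. -/
def partialState (ρ : Matrix (m × n) (m × n) ℂ) (c : m) : Matrix n n ℂ :=
  fun i j => ρ (c, i) (c, j)

/-- The conditional state `ρ_{Q | c}` of a state that is classical on its first register. -/
noncomputable def conditionalState (ρ : Matrix (m × n) (m × n) ℂ) (c : m) : Matrix n n ℂ :=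
  (ρ.trace / (partialState ρ c).trace) • partialState ρ c

end Linear

/-- The classical description of one round: key and test inputs, the output alphabets
`outA x`, `outB y` (inside common finite alphabets), the test function, and the joint
distribution `P x y t` of the inputs and of the test bit (`t = 0`: key generation round,
`t = 1`: test round). -/
structure Protocol (𝒳 𝒴 𝒜 ℬ 𝒞 : Type*) [Fintype 𝒳] [Fintype 𝒴] where
  keyX : Finset 𝒳
  keyY : Finset 𝒴
  testX : Finset 𝒳
  testY : Finset 𝒴
  outA : 𝒳 → Finset 𝒜
  outB : 𝒴 → Finset ℬ
  test : 𝒜 → ℬ → 𝒳 → 𝒴 → 𝒞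
  P : 𝒳 → 𝒴 → Fin 2 → ℝ
  P_nonneg : ∀ x y t, 0 ≤ P x y t
  P_sum : ∑ x, ∑ y, ∑ t, P x y t = 1
  P_key : ∀ x y, P x y 0 ≠ 0 → x ∈ keyX ∧ y ∈ keyY
  P_test : ∀ x y, P x y 1 ≠ 0 → x ∈ testX ∧ y ∈ testY

namespace Protocol

variable {𝒳 𝒴 𝒜 ℬ 𝒞 : Type*} [Fintype 𝒳] [Fintype 𝒴] (p : Protocol 𝒳 𝒴 𝒜 ℬ 𝒞)

/-- The probability that the round is a key generation round, `P(T = 0)`. -/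
def probKey : ℝ := ∑ x, ∑ y, p.P x y 0

/-- The conditional probability `P(X = x | T = 0)`. -/
noncomputable def probXKey (x : 𝒳) : ℝ := (∑ y, p.P x y 0) / p.probKey

/-- The test data: `⊥` (that is `none`) in key generation rounds, and the value of the test
function in test rounds. -/
def testData (a : 𝒜) (b : ℬ) (x : 𝒳) (y : 𝒴) (t : Fin 2) : Option 𝒞 :=
  if t = 0 then none else some (p.test a b x y)

end Protocol

/-- The measurement devices: for every input of Alice and of Bob a POVM on her, respectively
his, quantum system. -/
structure Devices {𝒳 𝒴 𝒜 ℬ 𝒞 : Type*} [Fintype 𝒳] [Fintype 𝒴] (p : Protocol 𝒳 𝒴 𝒜 ℬ 𝒞)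
    (qA qB : Type*) [Fintype qA] [Fintype qB] [DecidableEq qA] [DecidableEq qB] where
  M : 𝒳 → 𝒜 → Matrix qA qA ℂ
  N : 𝒴 → ℬ → Matrix qB qB ℂ
  M_pos : ∀ x, ∀ a ∈ p.outA x, (M x a).PosSemidef
  M_sum : ∀ x, ∑ a ∈ p.outA x, M x a = 1
  N_pos : ∀ y, ∀ b ∈ p.outB y, (N y b).PosSemidef
  N_sum : ∀ y, ∑ b ∈ p.outB y, N y b = 1

namespace Devices

variable {𝒳 𝒴 𝒜 ℬ 𝒞 : Type*} [Fintype 𝒳] [Fintype 𝒴] [Fintype 𝒜] [Fintype ℬ] [Fintype 𝒞]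
  [DecidableEq 𝒳] [DecidableEq 𝒴] [DecidableEq 𝒜] [DecidableEq 𝒞]
  {p : Protocol 𝒳 𝒴 𝒜 ℬ 𝒞}
  {qA qB e : Type*} [Fintype qA] [Fintype qB] [Fintype e]
  [DecidableEq qA] [DecidableEq qB] [DecidableEq e]
  (d : Devices p qA qB) (σ : Matrix (qA × qB × e) (qA × qB × e) ℂ)

/-- The output of the round for fixed `x, y, t`, on the registers `C̄ A E`:
`∑_{a,b} |c̄⟩⟨c̄| ⊗ |a⟩⟨a| ⊗ Tr_{Q_A Q_B}[(M_{a|x} ⊗ N_{b|y} ⊗ 1_E) σ]`. -/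
def roundOutput (x : 𝒳) (y : 𝒴) (t : Fin 2) :
    Matrix (Option 𝒞 × 𝒜 × e) (Option 𝒞 × 𝒜 × e) ℂ :=
  ∑ a ∈ p.outA x, ∑ b ∈ p.outB y,
    ketbra (p.testData a b x y t) ⊗ₖ (ketbra a ⊗ₖ
      traceLeft (traceLeft ((d.M x a ⊗ₖ (d.N y b ⊗ₖ (1 : Matrix e e ℂ))) * σ)))

/-- The output `ℳ(σ)` of the round, with the registers in the order `T Y C̄ A X E`:
`∑_{x,y,t} P(x,y,t) ℳ(σ)_{A C̄ E | x,y,t} ⊗ |x,y,t⟩⟨x,y,t|`. -/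
def output : Matrix (Fin 2 × 𝒴 × Option 𝒞 × 𝒜 × 𝒳 × e) (Fin 2 × 𝒴 × Option 𝒞 × 𝒜 × 𝒳 × e) ℂ :=
  fun i j => ∑ x, ∑ y, ∑ t, (p.P x y t : ℂ) *
    (ketbra t i.1 j.1 * ketbra y i.2.1 j.2.1 * ketbra x i.2.2.2.2.1 j.2.2.2.2.1 *
      d.roundOutput σ x y t (i.2.2.1, i.2.2.2.1, i.2.2.2.2.2) (j.2.2.1, j.2.2.2.1, j.2.2.2.2.2))

/-- The state `ℳ(σ)_{A X E | T = 0}`: condition on `T = 0`, then discard `Y` and `C̄`. -/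
noncomputable def keyState : Matrix (𝒜 × 𝒳 × e) (𝒜 × 𝒳 × e) ℂ :=
  traceLeft (traceLeft (conditionalState (d.output σ) 0))

/-- The entropy `H_α(A | T = 0, X E)` of `ℳ(σ)`. -/
noncomputable def keyEntropy (α : ℝ) : EReal := petzCondEntropy α (d.keyState σ)

/-- Eve's marginal `ℳ(σ)_E`. -/
def stateE : Matrix e e ℂ :=
  traceLeft (traceLeft (traceLeft (traceLeft (traceLeft (d.output σ)))))

/-- The state `ℳ(σ)_{A E | X = x} = ∑_a |a⟩⟨a| ⊗ Tr_{Q_A Q_B}[(M_{a|x} ⊗ 1 ⊗ 1) σ]`. -/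
def stateAE (x : 𝒳) : Matrix (𝒜 × e) (𝒜 × e) ℂ :=
  ∑ a ∈ p.outA x, ketbra a ⊗ₖ
    traceLeft (traceLeft ((d.M x a ⊗ₖ ((1 : Matrix qB qB ℂ) ⊗ₖ (1 : Matrix e e ℂ))) * σ))

/-- The trace `Tr[ℳ(σ)_{AE|X=x} ^ α · (1_A ⊗ ℳ(σ)_E ^ (1 - α))]`. -/
noncomputable def keyTrace (α : ℝ) (x : 𝒳) : ℝ :=
  (mpow (d.stateAE σ x) α * ((1 : Matrix 𝒜 𝒜 ℂ) ⊗ₖ mpow (d.stateE σ) (1 - α))).trace.re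

end Devices

section Polynomials

variable {e : Type*} [Fintype e] [DecidableEq e] {m : ℕ}

/-- `P(Z₁, …, Z_m) = 1 + (sin (απ) / π) ∑ᵢ (wᵢ / tᵢ) (1 + Zᵢ + Zᵢ† + (1 - tᵢ) Zᵢ† Zᵢ)`. -/
noncomputable def polyP (α : ℝ) (t w : Fin m → ℝ) (Z : Fin m → Matrix e e ℂ) : Matrix e e ℂ :=
  1 + (Real.sin (α * Real.pi) / Real.pi) •
    ∑ i, (w i / t i) • (1 + Z i + (Z i)ᴴ + (1 - t i) • ((Z i)ᴴ * Z i))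

/-- `Q(Z₁, …, Z_m) = (sin (απ) / π) ∑ᵢ wᵢ Zᵢ Zᵢ†`. -/
noncomputable def polyQ (α : ℝ) (w : Fin m → ℝ) (Z : Fin m → Matrix e e ℂ) : Matrix e e ℂ :=
  (Real.sin (α * Real.pi) / Real.pi) • ∑ i, w i • (Z i * (Z i)ᴴ)

end Polynomials

/-- The objective function
`∑_a Tr[σ (M_{a|x} ⊗ 1_{Q_B} ⊗ P(Z_{a,1}, …, Z_{a,m}) + 1_{Q_A Q_B} ⊗ Q(Z_{a,1}, …, Z_{a,m}))]`,
where every `Z a i` is an operator on Eve's system. -/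
noncomputable def Devices.objective {𝒳 𝒴 𝒜 ℬ 𝒞 : Type*} [Fintype 𝒳] [Fintype 𝒴]
    {p : Protocol 𝒳 𝒴 𝒜 ℬ 𝒞}
    {qA qB e : Type*} [Fintype qA] [Fintype qB] [Fintype e]
    [DecidableEq qA] [DecidableEq qB] [DecidableEq e]
    (d : Devices p qA qB) (σ : Matrix (qA × qB × e) (qA × qB × e) ℂ)
    (α : ℝ) {m : ℕ} (t w : Fin m → ℝ) (x : 𝒳) (Z : 𝒜 → Fin m → Matrix e e ℂ) : ℝ :=
  ∑ a ∈ p.outA x,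
    (σ * (d.M x a ⊗ₖ ((1 : Matrix qB qB ℂ) ⊗ₖ polyP α t w (Z a)) +
      (1 : Matrix qA qA ℂ) ⊗ₖ ((1 : Matrix qB qB ℂ) ⊗ₖ polyQ α w (Z a)))).trace.re

end DIRenyi

open DIRenyi

set_option linter.unusedSectionVars false

/-! For part (i), the state given `T = 0` is block diagonal in `A` and `X`, with blocks `P(x|0)
ρ_{x,a}`, where `ρ_{x,a}` is Eve's unnormalized state. Completeness of the POVMs gives `∑ a, ρ_{x,a}
= ρ_E` for every `x`, so the marginal on `X E` has blocks `P(x|0) ρ_E`. Powers act blockwise and `c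
^ α * c ^ (1 - α) = c`, so the Petz trace is the stated average over `x`. Domination is automatic,
since a sum of positive operators dominates each summand.

For part (ii), `x ^ (α - 1) - 1` is, up to a positive constant, the integral over `t ∈ (0, 1)` of
`(x - 1) / (t + (1 - t) x)` against a Jacobi weight. As a function of `t` this is a Cauchy kernel `1
/ (z - t)` with `z ∉ [0, 1]`. Gauss–Radau quadrature with fixed node `1` overestimates its integral
(`exists_cauchyKernel_le`), which gives a rational upper bound on the power
(`exists_rpow_le_gaussRadau`) with nodes and weights depending only on `α` and `m`.

The bound lifts to operators through the squared overlaps of the eigenbases of `ρ = ρ_{x,a}` and `τ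
= ρ_E`: the Petz trace is the overlap-weighted sum of `λ ^ α μ ^ (1 - α)`, and each rational term is
the minimum over real `z` of a quadratic in `z`. An operator `Z` assembled from these minimizers
realizes the sum (`exists_petzTrace_le`). As `sin (απ) < 0`, minimal cost means a large objective.
Completing a square, with `ρ ≤ τ`, bounds the objective above (`quadCost_ge`), so its supremum
dominates the value at this `Z`. -/

namespace DIRenyi

/-! ### Orthogonal polynomials and Gauss–Radau quadrature -/

section GaussRadau

open Polynomial

/-- A linear functional on real polynomials that is strictly positive on nonzero polynomials
that are nonnegative on `(0, 1)`. -/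
def StrictlyPositive (Λ : ℝ[X] →ₗ[ℝ] ℝ) : Prop :=
  ∀ p : ℝ[X], p ≠ 0 → (∀ t ∈ Set.Ioo (0 : ℝ) 1, 0 ≤ p.eval t) → 0 < Λ p

variable {Λ : ℝ[X] →ₗ[ℝ] ℝ}

lemma one_sub_X_ne_zero : (1 - X : ℝ[X]) ≠ 0 := by
  intro h
  have := congrArg (eval 0) h
  simp at this

/-- The orthogonal polynomial of degree `n` for the functional `p ↦ Λ ((1 - X) * p)`. -/
lemma StrictlyPositive.exists_orthogonal (hΛ : StrictlyPositive Λ) (n : ℕ) :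
    ∃ q : ℝ[X], q.Monic ∧ q.natDegree = n ∧
      ∀ r : ℝ[X], r.degree < n → Λ (q * r * (1 - X)) = 0 := by
  let B : ℝ[X] →ₗ[ℝ] ℝ[X] →ₗ[ℝ] ℝ :=
    LinearMap.mk₂ ℝ (fun p r => Λ (p * r * (1 - X)))
      (fun p p' r => by rw [← map_add]; congr 1; ring)
      (fun c p r => by rw [← map_smul]; simp)
      (fun p r r' => by rw [← map_add]; congr 1; ring)
      (fun c p r => by rw [← map_smul]; simp)
  have hB : ∀ p r, B p r = Λ (p * r * (1 - X)) := fun p r => rfl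
  -- The Gram map in degree below `n`. It is injective because `p ^ 2 * (1 - X)` has positive
  -- integral for `p ≠ 0`, hence bijective by dimension, so `X ^ n` has an orthogonal projection
  -- `r`.
  let F : degreeLT ℝ n →ₗ[ℝ] Module.Dual ℝ (degreeLT ℝ n) :=
    (degreeLT ℝ n).subtype.dualMap ∘ₗ B ∘ₗ (degreeLT ℝ n).subtype
  have hF : ∀ p r, F p r = Λ ((p : ℝ[X]) * (r : ℝ[X]) * (1 - X)) := fun p r => rfl
  have : FiniteDimensional ℝ (degreeLT ℝ n) := (degreeLTEquiv ℝ n).symm.finiteDimensional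
  have hinj : Function.Injective F := by
    rw [← LinearMap.ker_eq_bot, LinearMap.ker_eq_bot']
    intro p hp
    by_contra hne
    have hp0 : (p : ℝ[X]) ≠ 0 := by simpa using hne
    have h1 : F p p = 0 := by rw [hp]; rfl
    rw [hF] at h1
    refine (hΛ _ (mul_ne_zero (mul_ne_zero hp0 hp0) one_sub_X_ne_zero) fun t ht => ?_).ne' h1
    simpa using mul_nonneg (mul_self_nonneg _) (sub_nonneg.2 ht.2.le)
  obtain ⟨r, hr⟩ := (LinearMap.injective_iff_surjective_of_finrank_eq_finrank
    (Subspace.dual_finrank_eq (K := ℝ) (V := degreeLT ℝ n)).symm).1 hinj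
    ((degreeLT ℝ n).subtype.dualMap (B (X ^ n)))
  have hrd : (r : ℝ[X]).degree < n := mem_degreeLT.1 r.2
  refine ⟨X ^ n - (r : ℝ[X]), monic_X_pow_sub (by simpa using hrd), ?_, fun s hs => ?_⟩
  · exact natDegree_eq_of_degree_eq_some
      (by rw [degree_sub_eq_left_of_degree_lt (by simpa using hrd), degree_X_pow])
  · have := congrArg (fun f => f ⟨s, mem_degreeLT.2 hs⟩) hr
    simp only [hF] at this
    rw [sub_mul, sub_mul, map_sub, this]
    exact sub_self _

/-- An orthogonal polynomial has no nonconstant factor that is nonnegative on `(0, 1)`. -/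
lemma StrictlyPositive.natDegree_eq_zero_of_factor (hΛ : StrictlyPositive Λ) {q d h : ℝ[X]}
    (hq0 : q ≠ 0) (hq : ∀ r : ℝ[X], r.degree < q.natDegree → Λ (q * r * (1 - X)) = 0)
    (hdh : q = d * h) (hd : ∀ t ∈ Set.Ioo (0 : ℝ) 1, 0 ≤ d.eval t) : d.natDegree = 0 := by
  by_contra hne
  have hd0 : d ≠ 0 := by rintro rfl; simp at hdh; exact hq0 hdh
  have hh0 : h ≠ 0 := by rintro rfl; simp at hdh; exact hq0 hdh
  have hdeg : h.degree < q.natDegree := by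
    rw [degree_eq_natDegree hh0, hdh, natDegree_mul hd0 hh0]
    exact_mod_cast (by omega : h.natDegree < d.natDegree + h.natDegree)
  -- Test against the cofactor: `q * h * (1 - X) = d * h ^ 2 * (1 - X)` is nonnegative on `(0, 1)`,
  -- yet orthogonality annihilates it when `d` is nonconstant.
  refine (hΛ (q * h * (1 - X)) (mul_ne_zero (mul_ne_zero hq0 hh0) one_sub_X_ne_zero)
    fun t ht => ?_).ne' (hq h hdeg)
  have : eval t (q * h * (1 - X)) = d.eval t * (h.eval t * h.eval t) * (1 - t) := by
    rw [hdh]; simp only [eval_mul, eval_sub, eval_one, eval_X]; ring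
  rw [this]
  exact mul_nonneg (mul_nonneg (hd t ht) (mul_self_nonneg _)) (sub_nonneg.2 ht.2.le)

lemma StrictlyPositive.natDegree_eq_zero_of_factor' (hΛ : StrictlyPositive Λ) {q d h : ℝ[X]}
    (hq0 : q ≠ 0) (hq : ∀ r : ℝ[X], r.degree < q.natDegree → Λ (q * r * (1 - X)) = 0)
    (hdh : q = d * h) (hd : ∀ t ∈ Set.Ioo (0 : ℝ) 1, d.eval t ≤ 0) : d.natDegree = 0 := by
  rw [← natDegree_neg]
  exact hΛ.natDegree_eq_zero_of_factor (h := -h) hq0 hq (by rw [hdh]; ring)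
    fun t ht => by simpa using hd t ht

/-- A real polynomial without roots has constant sign. -/
lemma eval_pos_or_eval_neg_of_roots_eq_zero {h : ℝ[X]} (h0 : h ≠ 0) (hr : h.roots = 0) :
    (∀ t, 0 ≤ h.eval t) ∨ (∀ t, h.eval t ≤ 0) := by
  by_contra! hcon
  obtain ⟨⟨a, ha⟩, ⟨b, hb⟩⟩ := hcon
  obtain ⟨c, hc⟩ := mem_range_of_exists_le_of_exists_ge h.continuous ⟨a, ha.le⟩ ⟨b, hb.le⟩
  have : c ∈ h.roots := (mem_roots h0).2 hc
  rw [hr] at this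
  simp at this

/-- An orthogonal polynomial has the maximal number of simple roots, all of them in `(0, 1)`. -/
lemma StrictlyPositive.roots_of_orthogonal (hΛ : StrictlyPositive Λ) {q : ℝ[X]}
    (hq0 : q ≠ 0) (hq : ∀ r : ℝ[X], r.degree < q.natDegree → Λ (q * r * (1 - X)) = 0) :
    q.roots.card = q.natDegree ∧ q.roots.Nodup ∧ ∀ a ∈ q.roots, a ∈ Set.Ioo (0 : ℝ) 1 := by
  refine ⟨?_, ?_, ?_⟩
  · obtain ⟨h, hh, hdeg, hr⟩ := exists_prod_multiset_X_sub_C_mul q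
    have h0 : h ≠ 0 := by rintro rfl; simp at hh; exact hq0 hh.symm
    have : h.natDegree = 0 := by
      rcases eval_pos_or_eval_neg_of_roots_eq_zero h0 hr with hs | hs
      · exact hΛ.natDegree_eq_zero_of_factor hq0 hq (by rw [← hh, mul_comm]) fun t _ => hs t
      · exact hΛ.natDegree_eq_zero_of_factor' hq0 hq (by rw [← hh, mul_comm]) fun t _ => hs t
    omega
  · rw [Multiset.nodup_iff_count_le_one]
    intro a
    rw [count_roots]
    by_contra! hlt
    obtain ⟨h, hh⟩ := (le_rootMultiplicity_iff hq0).1 (show 2 ≤ q.rootMultiplicity a by omega)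
    have := hΛ.natDegree_eq_zero_of_factor hq0 hq hh fun t _ => by simpa using sq_nonneg _
    simp at this
  · intro a ha
    obtain ⟨h, hh⟩ := dvd_iff_isRoot.2 ((mem_roots hq0).1 ha)
    by_contra hmem
    rw [Set.mem_Ioo, not_and_or, not_lt, not_lt] at hmem
    have : (X - C a).natDegree = 0 := by
      rcases hmem with hle | hle
      · exact hΛ.natDegree_eq_zero_of_factor hq0 hq hh fun t ht => by
          simpa using hle.trans ht.1.le
      · exact hΛ.natDegree_eq_zero_of_factor' hq0 hq hh fun t ht => by
          simpa using ht.2.le.trans hle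
    simp at this

/-- **Gauss–Radau quadrature** with the fixed node `1`: there is a set `s` of `n + 1` nodes in
`(0, 1]` containing `1`, and positive weights, such that the quadrature rule is exact for
polynomials of degree at most `2 n`. -/
theorem StrictlyPositive.exists_gaussRadau (hΛ : StrictlyPositive Λ) (n : ℕ) :
    ∃ (s : Finset ℝ) (w : ℝ → ℝ), s.card = n + 1 ∧ (1 : ℝ) ∈ s ∧
      (∀ t ∈ s, 0 < t ∧ t ≤ 1) ∧ (∀ t ∈ s, 0 < w t) ∧
      ∀ p : ℝ[X], p.degree < ((2 * n + 1 : ℕ) : WithBot ℕ) → Λ p = ∑ t ∈ s, w t * p.eval t := by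
  obtain ⟨q, hmon, hdeg, horth⟩ := hΛ.exists_orthogonal n
  have hq0 := hmon.ne_zero
  obtain ⟨hcard, hnodup, hmem⟩ := hΛ.roots_of_orthogonal hq0 (by rwa [hdeg])
  have h1 : (1 : ℝ) ∉ q.roots.toFinset := fun h => by
    have := (hmem 1 (Multiset.mem_toFinset.1 h)).2
    exact lt_irrefl _ this
  set s : Finset ℝ := insert 1 q.roots.toFinset with hs
  have hscard : s.card = n + 1 := by
    rw [hs, Finset.card_insert_of_notMem h1, Multiset.toFinset_card_of_nodup hnodup, hcard, hdeg]
  have hinj : Set.InjOn (id : ℝ → ℝ) s := Function.injective_id.injOn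
  let w : ℝ → ℝ := fun t => Λ (Lagrange.basis s id t)
  -- Division by `ω` reduces exactness to interpolation: the remainder agrees with `p` at the nodes,
  -- and the quotient has degree below `n`, so orthogonality kills its contribution.
  let ω : ℝ[X] := q * (X - C 1)
  have hωmon : ω.Monic := hmon.mul (monic_X_sub_C 1)
  have hωdeg : ω.natDegree = n + 1 := by
    rw [hmon.natDegree_mul (monic_X_sub_C 1), hdeg, natDegree_X_sub_C]
  have hωeval : ∀ t ∈ s, ω.eval t = 0 := by
    intro t ht
    rcases Finset.mem_insert.1 ht with rfl | ht
    · simp [ω]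
    · have : q.eval t = 0 := (mem_roots hq0).1 (Multiset.mem_toFinset.1 ht)
      simp [ω, this]
  have hexact : ∀ p : ℝ[X], p.degree < ((2 * n + 1 : ℕ) : WithBot ℕ) →
      Λ p = ∑ t ∈ s, w t * p.eval t := by
    intro p hp
    have hr : (p %ₘ ω).degree < (s.card : WithBot ℕ) := by
      have := degree_modByMonic_lt p hωmon
      rwa [degree_eq_natDegree hωmon.ne_zero, hωdeg, ← hscard] at this
    have hh : (p /ₘ ω).degree < n := by
      by_cases h0 : p /ₘ ω = 0
      · rw [h0, degree_zero]; exact WithBot.bot_lt_coe _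
      have hp0 : p ≠ 0 := by rintro rfl; simp at h0
      rw [degree_eq_natDegree h0, natDegree_divByMonic p hωmon, hωdeg]
      rw [degree_eq_natDegree hp0] at hp
      have hp' : p.natDegree < 2 * n + 1 := by exact_mod_cast hp
      -- Needed for the truncated subtraction below; for `n = 0` a constant `p` has zero quotient.
      have : n ≠ 0 := by
        rintro rfl
        apply h0
        rw [divByMonic_eq_zero_iff hωmon, degree_eq_natDegree hp0,
          degree_eq_natDegree hωmon.ne_zero, hωdeg]
        exact_mod_cast hp'
      exact_mod_cast (by omega : p.natDegree - (n + 1) < n)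
    have heval : ∀ t ∈ s, p.eval t = (p %ₘ ω).eval t := by
      intro t ht
      conv_lhs => rw [← modByMonic_add_div p ω]
      simp [hωeval t ht]
    have hΛ0 : Λ (ω * (p /ₘ ω)) = 0 := by
      have h2 : ω * (p /ₘ ω) = -(q * (p /ₘ ω) * (1 - X)) := by simp [ω]; ring
      rw [h2, map_neg, horth _ hh, neg_zero]
    conv_lhs => rw [← modByMonic_add_div p ω]
    rw [map_add, hΛ0, add_zero, Lagrange.eq_interpolate hinj hr, Lagrange.interpolate_apply,
      map_sum]
    refine Finset.sum_congr rfl fun t ht => ?_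
    rw [← smul_eq_C_mul, map_smul, smul_eq_mul, heval t ht, mul_comm]
    rfl
  refine ⟨s, w, hscard, Finset.mem_insert_self _ _, ?_, ?_, hexact⟩
  · intro t ht
    rcases Finset.mem_insert.1 ht with rfl | ht
    · simp
    · exact ⟨(hmem t (Multiset.mem_toFinset.1 ht)).1, (hmem t (Multiset.mem_toFinset.1 ht)).2.le⟩
  · intro t ht
    -- The square of a Lagrange basis polynomial has degree `2 * n`, so exactness identifies the
    -- weight with its strictly positive integral.
    have hb0 := Lagrange.basis_ne_zero hinj ht
    have hbd : (Lagrange.basis s id t ^ 2).degree < ((2 * n + 1 : ℕ) : WithBot ℕ) := by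
      rw [degree_pow, Lagrange.degree_basis hinj ht, hscard]
      simp only [Nat.add_sub_cancel, nsmul_eq_mul]
      exact_mod_cast (by omega : 2 * n < 2 * n + 1)
    have hsum := hexact _ hbd
    rw [Finset.sum_eq_single_of_mem t ht] at hsum
    · have hself : (Lagrange.basis s id t).eval t = 1 := Lagrange.eval_basis_self hinj ht
      rw [eval_pow, hself] at hsum
      have := hΛ _ (pow_ne_zero 2 hb0) fun x _ => by simpa using sq_nonneg _
      rw [hsum] at this
      simpa using this
    · intro u hu hut
      have : (Lagrange.basis s id t).eval u = 0 := Lagrange.eval_basis_of_ne (v := id) hut.symm hu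
      simp [this]

end GaussRadau

/-! ### Integral representation and rational upper bound for the power function -/

section ScalarBound

open Polynomial MeasureTheory Set

/-- The Gauss–Radau rule overestimates the integral of a Cauchy kernel `t ↦ 1 / (z - t)` with
`z ∉ [0, 1]`, pointwise: the kernel lies below a polynomial of degree at most `2 n` that agrees
with it at the nodes. -/
lemma exists_cauchyKernel_le {s : Finset ℝ} {n : ℕ} (hs : s.card = n + 1) (h1 : (1 : ℝ) ∈ s)
    (hmem : ∀ t ∈ s, 0 < t ∧ t ≤ 1) {z : ℝ} (hz : z < 0 ∨ 1 < z) :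
    ∃ H : ℝ[X], H.degree < ((2 * n + 1 : ℕ) : WithBot ℕ) ∧
      (∀ t ∈ s, H.eval t = (z - t)⁻¹) ∧ ∀ t ∈ Ioo (0 : ℝ) 1, (z - t)⁻¹ ≤ H.eval t := by
  have hzs : ∀ t ∈ s, z - t ≠ 0 := by
    intro t ht h
    have := hmem t ht
    rcases hz with hz | hz <;> linarith
  set N : ℝ[X] := Lagrange.nodal (s.erase 1) id with hN
  -- Simple zero at the fixed node `1`, double zeros at the interior nodes: `ω` vanishes on `s` and
  -- is nonnegative on `(0, 1)`.
  set ω : ℝ[X] := (1 - X) * N ^ 2 with hω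
  have hNz : N.eval z ≠ 0 := by
    rw [hN, Lagrange.eval_nodal]
    exact Finset.prod_ne_zero_iff.2 fun t ht => hzs t (Finset.mem_of_mem_erase ht)
  have hωeval : ∀ t, ω.eval t = (1 - t) * N.eval t ^ 2 := fun t => by simp [hω]
  have hz1 : 1 - z ≠ 0 := by
    rw [← neg_sub]; exact neg_ne_zero.2 (hzs 1 h1)
  have hωz : ω.eval z ≠ 0 := by
    rw [hωeval]; exact mul_ne_zero hz1 (pow_ne_zero 2 hNz)
  have hωs : ∀ t ∈ s, ω.eval t = 0 := by
    intro t ht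
    rw [hωeval]
    by_cases h : t = 1
    · simp [h]
    · have : N.eval t = 0 :=
        Lagrange.eval_nodal_at_node (v := id) (Finset.mem_erase.2 ⟨h, ht⟩)
      simp [this]
  have hωdeg : ω.natDegree ≤ 2 * n + 1 := by
    refine natDegree_mul_le.trans ?_
    have h2 : (1 - X : ℝ[X]).natDegree ≤ 1 := by
      refine (natDegree_sub_le _ _).trans ?_
      simp
    have h3 : (N ^ 2).natDegree = 2 * n := by
      rw [natDegree_pow, hN, Lagrange.natDegree_nodal, Finset.card_erase_of_mem h1, hs]
      simp
    omega
  -- The majorant is `H t = (1 - ω t / ω z) / (z - t)`, a polynomial because the numerator vanishes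
  -- at `z`.
  have hroot : IsRoot (1 - C (ω.eval z)⁻¹ * ω) z := by
    simp [inv_mul_cancel₀ hωz]
  obtain ⟨G, hG⟩ := dvd_iff_isRoot.2 hroot
  have hGeval : ∀ t, (z - t) * (-G).eval t = 1 - (ω.eval z)⁻¹ * ω.eval t := by
    intro t
    have := congrArg (eval t) hG
    simp only [eval_sub, eval_one, eval_mul, eval_C, eval_X] at this
    rw [this, eval_neg]
    ring
  refine ⟨-G, ?_, ?_, ?_⟩
  · by_cases hG0 : G = 0
    · rw [hG0, neg_zero, degree_zero]; exact WithBot.bot_lt_coe _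
    rw [degree_neg, degree_eq_natDegree hG0]
    have h2 : (1 - C (ω.eval z)⁻¹ * ω).natDegree ≤ 2 * n + 1 := by
      refine (natDegree_sub_le _ _).trans (max_le (by simp) ?_)
      exact (natDegree_C_mul_le _ _).trans hωdeg
    rw [hG, natDegree_mul (X_sub_C_ne_zero z) hG0, natDegree_X_sub_C] at h2
    exact_mod_cast (by omega : G.natDegree < 2 * n + 1)
  · intro t ht
    have := hGeval t
    rw [hωs t ht, mul_zero, sub_zero] at this
    exact eq_inv_of_mul_eq_one_right this
  · intro t ht
    have h2 : (-G).eval t - (z - t)⁻¹ = -((ω.eval z)⁻¹ * (z - t)⁻¹) * ω.eval t := by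
      have h3 : z - t ≠ 0 := by
        intro h
        rcases hz with hz | hz <;> linarith [ht.1, ht.2]
      have := hGeval t
      field_simp at this ⊢
      linarith
    have h4 : 0 ≤ ω.eval t := by
      rw [hωeval]; exact mul_nonneg (sub_nonneg.2 ht.2.le) (sq_nonneg _)
    -- `ω z` has the sign of `1 - z`, which is opposite to that of `z - t` both for `z < 0` and for
    -- `z > 1`.
    have h5 : (ω.eval z)⁻¹ * (z - t)⁻¹ ≤ 0 := by
      rw [hωeval]
      rcases hz with hz | hz
      · exact mul_nonpos_of_nonneg_of_nonpos
          (inv_nonneg.2 (mul_nonneg (by linarith) (sq_nonneg _)))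
          (inv_nonpos.2 (by linarith [ht.1]))
      · exact mul_nonpos_of_nonpos_of_nonneg
          (inv_nonpos.2 (mul_nonpos_of_nonpos_of_nonneg (by linarith) (sq_nonneg _)))
          (inv_nonneg.2 (by linarith [ht.2]))
    have := mul_nonneg (neg_nonneg.2 h5) h4
    linarith

lemma div_one_add_mem_Ioo {u : ℝ} (hu : 0 < u) : u / (1 + u) ∈ Ioo (0 : ℝ) 1 := by
  have h : 0 < 1 + u := by linarith
  exact ⟨div_pos hu h, (div_lt_one h).2 (by linarith)⟩

/-- The weight `u ^ r / (1 + u) ^ 2` on the half-line; it is the image of the Jacobi weight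
`t ^ r (1 - t) ^ (- r)` on `(0, 1)` under `u = t / (1 - t)`. -/
noncomputable def jacobiWeight (r u : ℝ) : ℝ := u ^ r / (1 + u) ^ 2

lemma measurable_jacobiWeight (r : ℝ) : Measurable (jacobiWeight r) := by
  unfold jacobiWeight; fun_prop

lemma jacobiWeight_pos (r : ℝ) {u : ℝ} (hu : 0 < u) : 0 < jacobiWeight r u := by
  unfold jacobiWeight; positivity

/-- Domination by the integrand `u ^ r (1 / u - 1 / (u + 1))` of the integral representation of `1 ^
r`. -/
lemma integrableOn_jacobiWeight {r : ℝ} (hr : r ∈ Ioo (0 : ℝ) 1) :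
    IntegrableOn (jacobiWeight r) (Ioi 0) := by
  refine (Real.integrableOn_rpowIntegrand₀₁_Ioi hr (zero_le_one (α := ℝ))).mono'
    (measurable_jacobiWeight r).aestronglyMeasurable ?_
  refine (ae_restrict_mem measurableSet_Ioi).mono fun u (hu : 0 < u) => ?_
  rw [Real.norm_of_nonneg (jacobiWeight_pos r hu).le, jacobiWeight, Real.rpowIntegrand₀₁,
    div_eq_mul_inv]
  refine mul_le_mul_of_nonneg_left ?_ (by positivity)
  rw [← sub_nonneg]
  have : u⁻¹ - (u + 1)⁻¹ - ((1 + u) ^ 2)⁻¹ = 1 / (u * (1 + u) ^ 2) := by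
    field_simp; ring
  rw [this]
  positivity

/-- Integrability against the Jacobi weight of functions bounded on `(0, 1)`. -/
lemma integrableOn_jacobiWeight_mul {r : ℝ} (hr : r ∈ Ioo (0 : ℝ) 1) {f : ℝ → ℝ}
    (hf : Measurable f) {K : ℝ} (hK : ∀ t ∈ Ioo (0 : ℝ) 1, |f t| ≤ K) :
    IntegrableOn (fun u => jacobiWeight r u * f (u / (1 + u))) (Ioi 0) := by
  refine Integrable.mul_bdd (c := K) (integrableOn_jacobiWeight hr) ?_ ?_
  · exact (hf.comp (by fun_prop)).aestronglyMeasurable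
  · exact (ae_restrict_mem measurableSet_Ioi).mono fun u hu => hK _ (div_one_add_mem_Ioo hu)

lemma integrableOn_jacobiWeight_mul_eval {r : ℝ} (hr : r ∈ Ioo (0 : ℝ) 1) (p : ℝ[X]) :
    IntegrableOn (fun u => jacobiWeight r u * p.eval (u / (1 + u))) (Ioi 0) := by
  obtain ⟨K, hK⟩ := (isCompact_Icc (a := (0 : ℝ)) (b := 1)).exists_bound_of_continuousOn
    p.continuous.continuousOn
  exact integrableOn_jacobiWeight_mul hr p.continuous.measurable
    fun t ht => hK t (Ioo_subset_Icc_self ht)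

/-- Integration of polynomials against the Jacobi weight. -/
noncomputable def jacobiFunctional {r : ℝ} (hr : r ∈ Ioo (0 : ℝ) 1) : ℝ[X] →ₗ[ℝ] ℝ where
  toFun p := ∫ u in Ioi (0 : ℝ), jacobiWeight r u * p.eval (u / (1 + u))
  map_add' p q := by
    rw [← integral_add (integrableOn_jacobiWeight_mul_eval hr p)
      (integrableOn_jacobiWeight_mul_eval hr q)]
    simp [mul_add]
  map_smul' c p := by
    rw [RingHom.id_apply, smul_eq_mul, ← integral_const_mul]
    simp [mul_left_comm]

/-- Since `u ↦ u / (1 + u)` is injective on the positive half-line, the integrand vanishes there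
only at finitely many points, a null set. -/
lemma strictlyPositive_jacobiFunctional {r : ℝ} (hr : r ∈ Ioo (0 : ℝ) 1) :
    StrictlyPositive (jacobiFunctional hr) := by
  intro p hp hpos
  change 0 < ∫ u in Ioi (0 : ℝ), jacobiWeight r u * p.eval (u / (1 + u))
  rw [setIntegral_pos_iff_support_of_nonneg_ae _ (integrableOn_jacobiWeight_mul_eval hr p)]
  · set Z : Set ℝ := {u | 0 < u ∧ p.eval (u / (1 + u)) = 0} with hZ
    have hfin : Z.Finite := by
      refine Set.Finite.of_finite_image (f := fun u : ℝ => u / (1 + u))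
        ((p.roots.toFinset.finite_toSet).subset ?_) ?_
      · rintro _ ⟨u, hu, rfl⟩
        simpa [hp] using hu.2
      · intro u hu v hv huv
        have h1 : (1 + u) ≠ 0 := by have := hu.1; positivity
        have h2 : (1 + v) ≠ 0 := by have := hv.1; positivity
        simp only at huv
        rw [div_eq_div_iff h1 h2] at huv
        linarith
    have hsub : Ioi (0 : ℝ) ⊆
        (Function.support (fun u => jacobiWeight r u * p.eval (u / (1 + u))) ∩ Ioi 0) ∪ Z := by
      intro u (hu : 0 < u)
      by_cases h : p.eval (u / (1 + u)) = 0
      · exact Or.inr ⟨hu, h⟩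
      · exact Or.inl ⟨mul_ne_zero (jacobiWeight_pos r hu).ne' h, hu⟩
    by_contra hcon
    have h0 := le_antisymm (not_lt.1 hcon) zero_le
    have := (measure_mono (μ := volume) hsub).trans (measure_union_le _ _)
    rw [h0, hfin.measure_zero, add_zero, Real.volume_Ioi] at this
    simp at this
  · exact (ae_restrict_mem measurableSet_Ioi).mono fun u (hu : 0 < u) =>
      mul_nonneg (jacobiWeight_pos r hu).le (hpos _ (div_one_add_mem_Ioo hu))

/-- The integral representation of `x ^ r - 1`. -/
lemma rpow_sub_one_eq_integral {r : ℝ} (hr : r ∈ Ioo (0 : ℝ) 1) {x : ℝ} (hx : 0 < x) :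
    x ^ r - 1 = (∫ u in Ioi (0 : ℝ), Real.rpowIntegrand₀₁ r u 1)⁻¹ *
      ∫ u in Ioi (0 : ℝ), jacobiWeight r u *
        ((x - 1) / (u / (1 + u) + (1 - u / (1 + u)) * x)) := by
  -- Subtracting the representation at `1` cancels the `1 / u` terms and leaves `u ^ r (x - 1) / ((1
  -- + u) (u + x))`.
  have h1 := Real.rpow_eq_const_mul_integral hr (zero_le_one (α := ℝ))
  rw [Real.one_rpow] at h1
  nth_rewrite 1 [h1]
  rw [Real.rpow_eq_const_mul_integral hr hx.le, ← mul_sub,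
    ← integral_sub (Real.integrableOn_rpowIntegrand₀₁_Ioi hr hx.le)
      (Real.integrableOn_rpowIntegrand₀₁_Ioi hr zero_le_one)]
  congr 1
  refine setIntegral_congr_fun measurableSet_Ioi fun u (hu : 0 < u) => ?_
  have h2 : u / (1 + u) + (1 - u / (1 + u)) * x = (u + x) / (1 + u) := by
    field_simp; ring
  simp only [Real.rpowIntegrand₀₁, jacobiWeight]
  rw [h2]
  field_simp
  ring

/-- The Gauss–Radau upper bound on the power function with exponent in `(0, 1)`. -/
theorem exists_rpow_le_gaussRadau {r : ℝ} (hr : r ∈ Ioo (0 : ℝ) 1) {m : ℕ} (hm : 1 ≤ m) :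
    ∃ t w : Fin m → ℝ, Function.Injective t ∧ (∀ i, 0 < t i ∧ t i ≤ 1) ∧ (∀ i, 0 < w i) ∧
      ∀ x : ℝ, 0 < x → x ^ r ≤ 1 + ∑ i, w i * ((x - 1) / (t i + (1 - t i) * x)) := by
  obtain ⟨n, rfl⟩ : ∃ n, m = n + 1 := ⟨m - 1, by omega⟩
  obtain ⟨s, w, hcard, h1, hmem, hw, hexact⟩ :=
    (strictlyPositive_jacobiFunctional hr).exists_gaussRadau n
  set c := ∫ u in Ioi (0 : ℝ), Real.rpowIntegrand₀₁ r u 1 with hc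
  have hcpos : 0 < c := Real.integral_rpowIntegrand₀₁_one_pos hr
  let e : s ≃ Fin (n + 1) := s.equivFinOfCardEq hcard
  refine ⟨fun i => e.symm i, fun i => c⁻¹ * w (e.symm i),
    Subtype.val_injective.comp e.symm.injective, fun i => hmem _ (e.symm i).2,
    fun i => mul_pos (inv_pos.2 hcpos) (hw _ (e.symm i).2), fun x hx => ?_⟩
  have hsum : ∑ i, c⁻¹ * w (e.symm i) *
      ((x - 1) / ((e.symm i : ℝ) + (1 - (e.symm i : ℝ)) * x)) =
      c⁻¹ * ∑ t ∈ s, w t * ((x - 1) / (t + (1 - t) * x)) := by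
    rw [e.symm.sum_comp fun t : s => c⁻¹ * w t * ((x - 1) / ((t : ℝ) + (1 - (t : ℝ)) * x)),
      Finset.sum_coe_sort s fun t => c⁻¹ * w t * ((x - 1) / (t + (1 - t) * x)), Finset.mul_sum]
    simp only [mul_assoc]
  rw [hsum, ← sub_le_iff_le_add', rpow_sub_one_eq_integral hr hx]
  refine mul_le_mul_of_nonneg_left ?_ (inv_nonneg.2 hcpos.le)
  -- At `x = 1` both sides vanish; otherwise the pole is `z = x / (x - 1)`.
  rcases eq_or_ne x 1 with rfl | hx1
  · simp
  have hx1' : x - 1 ≠ 0 := sub_ne_zero.2 hx1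
  have hz : x / (x - 1) < 0 ∨ 1 < x / (x - 1) := by
    rcases lt_or_gt_of_ne hx1' with h | h
    · exact Or.inl (div_neg_of_pos_of_neg hx h)
    · exact Or.inr ((one_lt_div h).2 (by linarith))
  have hker : ∀ t : ℝ, (x - 1) / (t + (1 - t) * x) = (x / (x - 1) - t)⁻¹ := by
    intro t
    rw [← inv_div]
    congr 1
    field_simp
    ring
  obtain ⟨H, hHdeg, hHs, hHle⟩ := exists_cauchyKernel_le hcard h1 hmem hz
  have hH := hexact H hHdeg
  rw [Finset.sum_congr rfl fun t ht => by rw [hHs t ht, ← hker t]] at hH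
  rw [← hH]
  refine setIntegral_mono_on ?_ (integrableOn_jacobiWeight_mul_eval hr H) measurableSet_Ioi ?_
  · refine integrableOn_jacobiWeight_mul hr (f := fun t => (x - 1) / (t + (1 - t) * x))
      (K := |x - 1| / min x 1) (by fun_prop) fun t ht => ?_
    have hle : min x 1 ≤ t + (1 - t) * x := by
      nlinarith [min_le_left x 1, min_le_right x 1, ht.1, ht.2]
    have hpos : 0 < min x 1 := lt_min hx one_pos
    rw [abs_div, abs_of_pos (hpos.trans_le hle)]
    exact div_le_div_of_nonneg_left (abs_nonneg _) hpos hle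
  · intro u hu
    refine mul_le_mul_of_nonneg_left ?_ (jacobiWeight_pos r hu).le
    rw [hker]
    exact hHle _ (div_one_add_mem_Ioo hu)

end ScalarBound

/-! ### Powers of block diagonal operators -/

section Power

open Polynomial

variable {n ι : Type*} [Fintype n] [DecidableEq n] [Fintype ι] [DecidableEq ι]

lemma mpow_eq_aeval {A : Matrix n n ℂ} (hA : A.IsHermitian) {s : ℝ} {p : ℝ[X]}
    (hp : ∀ x ∈ spectrum ℝ A, p.eval x = x ^ s) : mpow A s = aeval A p := by
  have hA' : IsSelfAdjoint A := hA
  rw [mpow, ← cfc_polynomial p A hA']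
  exact cfc_congr fun x hx => (hp x hx).symm

/-- The power of a Hermitian matrix in its eigenbasis. -/
lemma mpow_eq_conj_diagonal {A : Matrix n n ℂ} (hA : A.IsHermitian) (s : ℝ) :
    mpow A s = (hA.eigenvectorUnitary : Matrix n n ℂ) *
      Matrix.diagonal (fun i => ((hA.eigenvalues i ^ s : ℝ) : ℂ)) *
      (hA.eigenvectorUnitary : Matrix n n ℂ)ᴴ := by
  rw [mpow, hA.cfc_eq, Matrix.IsHermitian.cfc, Unitary.conjStarAlgAut_apply]
  rfl

lemma eq_conj_diagonal {A : Matrix n n ℂ} (hA : A.IsHermitian) :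
    A = (hA.eigenvectorUnitary : Matrix n n ℂ) *
      Matrix.diagonal (fun i => ((hA.eigenvalues i : ℝ) : ℂ)) *
      (hA.eigenvectorUnitary : Matrix n n ℂ)ᴴ := by
  conv_lhs => rw [hA.spectral_theorem, Unitary.conjStarAlgAut_apply]
  rfl

lemma mpow_smul {A : Matrix n n ℂ} (hA : A.PosSemidef) {c : ℝ} (hc : 0 ≤ c) (s : ℝ) :
    mpow (c • A) s = (c ^ s) • mpow A s := by
  have hA' : IsSelfAdjoint A := hA.1
  have hcont : ∀ f : ℝ → ℝ, ContinuousOn f (spectrum ℝ A) := fun f =>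
    (Matrix.finite_real_spectrum (A := A)).continuousOn f
  have hcont' : ∀ f : ℝ → ℝ, ContinuousOn f ((fun x => c • x) '' spectrum ℝ A) := fun f =>
    ((Matrix.finite_real_spectrum (A := A)).image _).continuousOn f
  rw [mpow, mpow, ← cfc_comp_smul c _ A (hcont' _) hA', ← cfc_smul (c ^ s) _ A (hcont _)]
  refine cfc_congr fun x hx => ?_
  rw [hA.1.spectrum_real_eq_range_eigenvalues] at hx
  obtain ⟨i, rfl⟩ := hx
  exact Real.mul_rpow hc (hA.eigenvalues_nonneg i)

/-- The block diagonal operator `∑ i, |i⟩⟨i| ⊗ B i`. -/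
def directSum (B : ι → Matrix n n ℂ) : Matrix (ι × n) (ι × n) ℂ :=
  fun i j => if i.1 = j.1 then B i.1 i.2 j.2 else 0

/-- Block diagonal operators as an algebra homomorphism. -/
noncomputable def directSumAlgHom : (ι → Matrix n n ℂ) →ₐ[ℝ] Matrix (ι × n) (ι × n) ℂ :=
  AlgHom.ofLinearMap
    { toFun := directSum
      map_add' := fun A B => by
        ext i j
        simp only [directSum, Matrix.add_apply, Pi.add_apply]
        split_ifs <;> simp
      map_smul' := fun c A => by
        ext i j
        simp only [directSum, Matrix.smul_apply, Pi.smul_apply, RingHom.id_apply]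
        split_ifs <;> simp }
    (by
      ext ⟨i, k⟩ ⟨j, l⟩
      simp only [LinearMap.coe_mk, AddHom.coe_mk, directSum, Matrix.one_apply, Pi.one_apply,
        Prod.mk.injEq]
      split_ifs <;> simp_all)
    (fun A B => by
      ext ⟨i, k⟩ ⟨j, l⟩
      simp only [LinearMap.coe_mk, AddHom.coe_mk, directSum, Matrix.mul_apply, Pi.mul_apply,
        Fintype.sum_prod_type, ite_mul, mul_ite, zero_mul, mul_zero]
      rw [Finset.sum_eq_single i (fun b _ hb => by simp [hb.symm]) (by simp)]
      by_cases h : i = j <;> simp [h])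

lemma directSumAlgHom_apply (B : ι → Matrix n n ℂ) : directSumAlgHom B = directSum B := rfl

lemma directSum_mul (A B : ι → Matrix n n ℂ) :
    directSum A * directSum B = directSum fun i => A i * B i :=
  (map_mul directSumAlgHom A B).symm

lemma sum_directSum {κ : Type*} (s : Finset κ) (A : κ → ι → Matrix n n ℂ) :
    ∑ k ∈ s, directSum (A k) = directSum fun i => ∑ k ∈ s, A k i := by
  ext i j
  simp only [Matrix.sum_apply, directSum]
  split_ifs <;> simp

lemma trace_directSum (A : ι → Matrix n n ℂ) : (directSum A).trace = ∑ i, (A i).trace := by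
  simp [Matrix.trace, directSum, Fintype.sum_prod_type]

lemma one_kronecker_eq_directSum (A : Matrix n n ℂ) :
    (1 : Matrix ι ι ℂ) ⊗ₖ A = directSum fun _ => A := by
  ext ⟨i, k⟩ ⟨j, l⟩
  simp [directSum, Matrix.one_apply]

lemma traceLeft_directSum (A : ι → Matrix n n ℂ) : traceLeft (directSum A) = ∑ i, A i := by
  ext k l
  simp [traceLeft, directSum, Matrix.sum_apply]

lemma directSum_mulVec (A : ι → Matrix n n ℂ) (v : ι × n → ℂ) (i : ι) (k : n) :
    (directSum A *ᵥ v) (i, k) = (A i *ᵥ fun l => v (i, l)) k := by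
  simp only [Matrix.mulVec, dotProduct, directSum, Fintype.sum_prod_type, ite_mul, zero_mul]
  rw [Finset.sum_eq_single i (fun b _ hb => by simp [hb.symm]) (by simp)]
  simp

lemma posSemidef_directSum {A : ι → Matrix n n ℂ} (hA : ∀ i, (A i).PosSemidef) :
    (directSum A).PosSemidef := by
  refine Matrix.PosSemidef.of_dotProduct_mulVec_nonneg ?_ fun v => ?_
  · ext ⟨i, k⟩ ⟨j, l⟩
    simp only [Matrix.conjTranspose_apply, directSum]
    split_ifs with h1 h2 h2
    · subst h1; exact (hA j).1.apply k l
    · exact absurd h1.symm h2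
    · exact absurd h2.symm h1
    · simp
  · rw [dotProduct, Fintype.sum_prod_type]
    refine Finset.sum_nonneg fun i _ => ?_
    simp only [directSum_mulVec]
    exact (hA i).dotProduct_mulVec_nonneg fun l => v (i, l)

/-- One polynomial interpolates the power on the spectra of the direct sum and of all blocks;
polynomials commute with algebra homomorphisms. -/
lemma mpow_directSum {A : ι → Matrix n n ℂ} (hA : ∀ i, (A i).PosSemidef) (s : ℝ) :
    mpow (directSum A) s = directSum fun i => mpow (A i) s := by
  have hfin : (spectrum ℝ (directSum A) ∪ ⋃ i, spectrum ℝ (A i)).Finite :=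
    Matrix.finite_real_spectrum.union (Set.finite_iUnion fun i => Matrix.finite_real_spectrum)
  obtain ⟨p, hp⟩ : ∃ p : ℝ[X], ∀ x ∈ spectrum ℝ (directSum A) ∪ ⋃ i, spectrum ℝ (A i),
      p.eval x = x ^ s :=
    ⟨Lagrange.interpolate hfin.toFinset id fun x => x ^ s, fun x hx =>
      Lagrange.eval_interpolate_at_node (v := id) _ Function.injective_id.injOn
        (hfin.mem_toFinset.2 hx)⟩
  rw [mpow_eq_aeval (posSemidef_directSum hA).1 fun x hx => hp x (Or.inl hx),
    ← directSumAlgHom_apply, aeval_algHom_apply, directSumAlgHom_apply]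
  congr 1
  funext i
  rw [mpow_eq_aeval (hA i).1 fun x hx => hp x (Or.inr (Set.mem_iUnion.2 ⟨i, hx⟩))]
  exact (aeval_algHom_apply (Pi.evalAlgHom ℝ (fun _ : ι => Matrix n n ℂ) i) A p).symm

lemma petzTrace_directSum {A B : ι → Matrix n n ℂ} (hA : ∀ i, (A i).PosSemidef)
    (hB : ∀ i, (B i).PosSemidef) (α : ℝ) :
    petzTrace α (directSum A) (directSum B) = ∑ i, petzTrace α (A i) (B i) := by
  simp only [petzTrace, mpow_directSum hA, mpow_directSum hB, directSum_mul, trace_directSum,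
    Complex.re_sum]

/-- This homogeneity of degree one is what makes the input probabilities enter the entropy formula
linearly. -/
lemma petzTrace_smul_smul {A B : Matrix n n ℂ} (hA : A.PosSemidef) (hB : B.PosSemidef)
    {α c : ℝ} (hα : 1 < α) (hc : 0 ≤ c) :
    petzTrace α (c • A) (c • B) = c * petzTrace α A B := by
  have hcc : c ^ α * c ^ (1 - α) = c := by
    rcases hc.eq_or_lt with rfl | hc
    · rw [Real.zero_rpow (by linarith), zero_mul]
    · rw [← Real.rpow_add hc]; simp
  rw [petzTrace, petzTrace, mpow_smul hA hc, mpow_smul hB hc, smul_mul_smul_comm,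
    Matrix.trace_smul, Complex.smul_re, hcc, smul_eq_mul]

/-- A sum of positive semidefinite operators dominates each summand. -/
lemma dominated_sum {A : ι → Matrix n n ℂ} (hA : ∀ i, (A i).PosSemidef) (i : ι) :
    Dominated (A i) (∑ j, A j) := by
  intro v hv
  rw [← (hA i).dotProduct_mulVec_zero_iff]
  have h0 : ∑ j, star v ⬝ᵥ (A j *ᵥ v) = 0 := by
    rw [← dotProduct_sum, ← Matrix.sum_mulVec, hv, dotProduct_zero]
  exact (Finset.sum_eq_zero_iff_of_nonneg fun j _ => (hA j).dotProduct_mulVec_nonneg v).1 h0 i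
    (Finset.mem_univ i)

end Power

/-! ### Quadratic costs and the spectral overlap expansion -/

section Variational

variable {n : Type*} [Fintype n] [DecidableEq n]

/-- The quadratic cost `Tr[ρ (1 + Z + Z† + (1 - t) Z† Z)] + t Tr[τ Z Z†]`. -/
noncomputable def quadCost (t : ℝ) (ρ τ Z : Matrix n n ℂ) : ℝ :=
  (ρ * (1 + Z + Zᴴ + (1 - t) • (Zᴴ * Z))).trace.re + t * (τ * (Z * Zᴴ)).trace.re

/-- Writing `w i = (w i / t i) * t i` puts the `Q` term under the same prefactor as the `P` term. -/
lemma trace_polyP_add_trace_polyQ {m : ℕ} (α : ℝ) {t : Fin m → ℝ} (ht : ∀ i, 0 < t i)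
    (w : Fin m → ℝ) (ρ τ : Matrix n n ℂ) (Z : Fin m → Matrix n n ℂ) :
    (ρ * polyP α t w Z).trace.re + (τ * polyQ α w Z).trace.re =
      ρ.trace.re + Real.sin (α * Real.pi) / Real.pi *
        ∑ i, w i / t i * quadCost (t i) ρ τ (Z i) := by
  simp only [polyP, polyQ, mul_add, mul_one, Matrix.mul_smul, Matrix.trace_add, Matrix.trace_smul,
    Complex.add_re, Complex.smul_re, Matrix.mul_sum, Matrix.trace_sum, Complex.re_sum, quadCost,
    smul_eq_mul]
  rw [add_assoc, ← mul_add, ← Finset.sum_add_distrib]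
  congr 2
  refine Finset.sum_congr rfl fun i _ => ?_
  have := (ht i).ne'
  field_simp

open scoped MatrixOrder Matrix.Norms.L2Operator in
lemma exists_eq_conjTranspose_mul_self {B : Matrix n n ℂ} (hB : B.PosSemidef) :
    ∃ C : Matrix n n ℂ, B = Cᴴ * C :=
  CStarAlgebra.nonneg_iff_eq_star_mul_self.mp hB.nonneg

lemma trace_mul_nonneg {A B : Matrix n n ℂ} (hA : A.PosSemidef) (hB : B.PosSemidef) :
    0 ≤ (A * B).trace.re := by
  obtain ⟨C, rfl⟩ := exists_eq_conjTranspose_mul_self hB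
  rw [← mul_assoc, Matrix.trace_mul_comm, ← mul_assoc]
  exact (Complex.nonneg_iff.1 (hA.mul_mul_conjTranspose_same C).trace_nonneg).1

/-- The quadratic cost is bounded below when `ρ ≤ τ`. -/
lemma quadCost_ge {t : ℝ} (ht : 0 < t) (ht1 : t ≤ 1) {ρ τ : Matrix n n ℂ} (hρ : ρ.PosSemidef)
    (hτ : (τ - ρ).PosSemidef) (Z : Matrix n n ℂ) :
    (1 - 1 / t) * ρ.trace.re ≤ quadCost t ρ τ Z := by
  have h1 := trace_mul_nonneg hρ (Matrix.posSemidef_conjTranspose_mul_self Z)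
  have h2 := trace_mul_nonneg hτ (Matrix.posSemidef_self_mul_conjTranspose Z)
  -- The shift `1 / t` completes the square: after multiplication by `t`, the cross terms are
  -- exactly `Z + Zᴴ`.
  have h3 := trace_mul_nonneg hρ
    (Matrix.posSemidef_self_mul_conjTranspose (Z + (1 / t) • (1 : Matrix n n ℂ)))
  have h4 : (Z + (1 / t) • (1 : Matrix n n ℂ)) * (Z + (1 / t) • (1 : Matrix n n ℂ))ᴴ =
      Z * Zᴴ + (1 / t) • Z + (1 / t) • Zᴴ + (1 / t * (1 / t)) • (1 : Matrix n n ℂ) := by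
    simp only [Matrix.conjTranspose_add, Matrix.conjTranspose_smul, star_trivial,
      Matrix.conjTranspose_one, add_mul, mul_add, smul_mul_assoc, mul_smul_comm, mul_one, one_mul,
      smul_add, smul_smul]
    abel
  rw [h4] at h3
  simp only [sub_mul, mul_add, Matrix.trace_add, Matrix.trace_sub, Complex.add_re, Complex.sub_re,
    Matrix.mul_smul, Matrix.trace_smul, Complex.smul_re, mul_one, smul_eq_mul, quadCost] at *
  have h5 := mul_nonneg ht.le h3
  have h6 := mul_nonneg ht.le h2
  have h7 := mul_nonneg (sub_nonneg.2 ht1) h1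
  have e1 : t * ((ρ * (Z * Zᴴ)).trace.re + 1 / t * (ρ * Z).trace.re + 1 / t * (ρ * Zᴴ).trace.re +
      1 / t * (1 / t) * ρ.trace.re) = t * (ρ * (Z * Zᴴ)).trace.re + (ρ * Z).trace.re +
      (ρ * Zᴴ).trace.re + 1 / t * ρ.trace.re := by field_simp
  rw [e1] at h5
  linarith

/-- The entrywise rescaling of a matrix by a real kernel. -/
def rescale (z : n → n → ℝ) (W : Matrix n n ℂ) : Matrix n n ℂ := fun k j => (z k j : ℂ) * W k j

lemma trace_diagonal_rescale (a b : n → ℝ) (x z : n → n → ℝ) (W : Matrix n n ℂ) :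
    (Matrix.diagonal (fun j => (a j : ℂ)) * ((rescale x W)ᴴ *
      (Matrix.diagonal (fun k => (b k : ℂ)) * rescale z W))).trace.re =
      ∑ k, ∑ j, Complex.normSq (W k j) * (a j * b k * x k j * z k j) := by
  rw [Finset.sum_comm]
  simp only [Matrix.trace, Matrix.diag, Matrix.diagonal_mul, Complex.re_sum]
  refine Finset.sum_congr rfl fun j _ => ?_
  rw [Matrix.mul_apply, Finset.mul_sum, Complex.re_sum]
  refine Finset.sum_congr rfl fun k _ => ?_
  rw [Matrix.diagonal_mul, Matrix.conjTranspose_apply]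
  simp only [rescale]
  have : (a j : ℂ) * (star ((x k j : ℂ) * W k j) * ((b k : ℂ) * ((z k j : ℂ) * W k j))) =
      ((Complex.normSq (W k j) * (a j * b k * x k j * z k j) : ℝ) : ℂ) := by
    rw [star_mul', RCLike.star_def, Complex.conj_ofReal]
    push_cast
    rw [Complex.normSq_eq_conj_mul_self]
    ring
  rw [this, Complex.ofReal_re]

section Spectral

variable {ρ τ : Matrix n n ℂ} (hρ : ρ.IsHermitian) (hτ : τ.IsHermitian)

/-- The overlaps `⟨v_k, u_j⟩` of the eigenvectors of `τ` with those of `ρ`. -/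
noncomputable def overlap : Matrix n n ℂ :=
  (hτ.eigenvectorUnitary : Matrix n n ℂ)ᴴ * (hρ.eigenvectorUnitary : Matrix n n ℂ)

/-- The operator `V ζ U†`, where `ζ` is the overlap matrix rescaled by a real kernel `z`. -/
noncomputable def spectralOperator (z : n → n → ℝ) : Matrix n n ℂ :=
  (hτ.eigenvectorUnitary : Matrix n n ℂ) * rescale z (overlap hρ hτ) *
    (hρ.eigenvectorUnitary : Matrix n n ℂ)ᴴ

lemma eigenvectorUnitary_conjTranspose_mul_self :
    (hρ.eigenvectorUnitary : Matrix n n ℂ)ᴴ * (hρ.eigenvectorUnitary : Matrix n n ℂ) = 1 :=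
  Unitary.coe_star_mul_self hρ.eigenvectorUnitary

lemma eigenvectorUnitary_mul_conjTranspose_self :
    (hρ.eigenvectorUnitary : Matrix n n ℂ) * (hρ.eigenvectorUnitary : Matrix n n ℂ)ᴴ = 1 :=
  Unitary.coe_mul_star_self hρ.eigenvectorUnitary

/-- The operator attached to the constant kernel `1` is the identity. -/
lemma spectralOperator_one : spectralOperator hρ hτ (fun _ _ => 1) = 1 := by
  have h : rescale (fun _ _ => 1) (overlap hρ hτ) = overlap hρ hτ := by
    ext; simp [rescale]
  rw [spectralOperator, h, overlap, ← mul_assoc, eigenvectorUnitary_mul_conjTranspose_self,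
    one_mul, eigenvectorUnitary_mul_conjTranspose_self]

/-- Master formula: the unitaries cancel cyclically. Choosing constant kernels or constant diagonals
`1` yields every trace occurring in the Petz trace and in the quadratic cost. -/
lemma trace_conj_diagonal_spectralOperator (a b : n → ℝ) (x z : n → n → ℝ) :
    ((hρ.eigenvectorUnitary : Matrix n n ℂ) * Matrix.diagonal (fun j => (a j : ℂ)) *
        (hρ.eigenvectorUnitary : Matrix n n ℂ)ᴴ * ((spectralOperator hρ hτ x)ᴴ *
      (((hτ.eigenvectorUnitary : Matrix n n ℂ) * Matrix.diagonal (fun k => (b k : ℂ)) *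
        (hτ.eigenvectorUnitary : Matrix n n ℂ)ᴴ) * spectralOperator hρ hτ z))).trace.re =
      ∑ k, ∑ j, Complex.normSq (overlap hρ hτ k j) * (a j * b k * x k j * z k j) := by
  rw [← trace_diagonal_rescale, spectralOperator, spectralOperator]
  have hU := eigenvectorUnitary_conjTranspose_mul_self hρ
  have hV := eigenvectorUnitary_conjTranspose_mul_self hτ
  set U := (hρ.eigenvectorUnitary : Matrix n n ℂ)
  set V := (hτ.eigenvectorUnitary : Matrix n n ℂ)
  simp only [Matrix.conjTranspose_mul, Matrix.conjTranspose_conjTranspose, mul_assoc]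
  rw [Matrix.trace_mul_comm]
  simp only [mul_assoc]
  rw [hU, mul_one, ← mul_assoc Uᴴ U, hU, one_mul, ← mul_assoc Vᴴ V, hV, one_mul, ← mul_assoc Vᴴ V,
    hV, one_mul]

lemma petzTrace_eq_sum (α : ℝ) :
    petzTrace α ρ τ = ∑ k, ∑ j, Complex.normSq (overlap hρ hτ k j) *
      (hρ.eigenvalues j ^ α * hτ.eigenvalues k ^ (1 - α)) := by
  have := trace_conj_diagonal_spectralOperator hρ hτ (fun j => hρ.eigenvalues j ^ α)
    (fun k => hτ.eigenvalues k ^ (1 - α)) (fun _ _ => 1) (fun _ _ => 1)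
  rw [spectralOperator_one, ← mpow_eq_conj_diagonal hρ α, ← mpow_eq_conj_diagonal hτ (1 - α),
    Matrix.conjTranspose_one, one_mul, mul_one] at this
  simpa [petzTrace] using this

lemma conj_diagonal_one :
    (hτ.eigenvectorUnitary : Matrix n n ℂ) * Matrix.diagonal (fun _ => ((1 : ℝ) : ℂ)) *
      (hτ.eigenvectorUnitary : Matrix n n ℂ)ᴴ = 1 := by
  simp only [Complex.ofReal_one, Matrix.diagonal_one, mul_one]
  exact eigenvectorUnitary_mul_conjTranspose_self hτ

lemma trace_mul_spectralOperator (x z : n → n → ℝ) :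
    (ρ * ((spectralOperator hρ hτ x)ᴴ * spectralOperator hρ hτ z)).trace.re =
      ∑ k, ∑ j, Complex.normSq (overlap hρ hτ k j) * (hρ.eigenvalues j * x k j * z k j) := by
  have := trace_conj_diagonal_spectralOperator hρ hτ hρ.eigenvalues (fun _ => 1) x z
  rw [conj_diagonal_one, one_mul, ← eq_conj_diagonal hρ] at this
  simpa using this

lemma trace_mul_spectralOperator' (z : n → n → ℝ) :
    (τ * (spectralOperator hρ hτ z * (spectralOperator hρ hτ z)ᴴ)).trace.re =
      ∑ k, ∑ j, Complex.normSq (overlap hρ hτ k j) * (hτ.eigenvalues k * z k j * z k j) := by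
  have := trace_conj_diagonal_spectralOperator hρ hτ (fun _ => 1) hτ.eigenvalues z z
  rw [conj_diagonal_one, one_mul, ← eq_conj_diagonal hτ, Matrix.trace_mul_comm, mul_assoc] at this
  simpa using this

lemma trace_eq_sum : ρ.trace.re =
    ∑ k, ∑ j, Complex.normSq (overlap hρ hτ k j) * hρ.eigenvalues j := by
  have := trace_mul_spectralOperator hρ hτ (fun _ _ => 1) (fun _ _ => 1)
  simpa [spectralOperator_one] using this

lemma quadCost_spectralOperator (t : ℝ) (z : n → n → ℝ) :
    quadCost t ρ τ (spectralOperator hρ hτ z) =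
      ∑ k, ∑ j, Complex.normSq (overlap hρ hτ k j) *
        (hρ.eigenvalues j * (1 + 2 * z k j + (1 - t) * z k j ^ 2) +
          t * hτ.eigenvalues k * z k j ^ 2) := by
  have h1 := trace_eq_sum hρ hτ
  have h2 := trace_mul_spectralOperator hρ hτ (fun _ _ => 1) z
  have h3 := trace_mul_spectralOperator hρ hτ z (fun _ _ => 1)
  have h4 := trace_mul_spectralOperator hρ hτ z z
  have h5 := trace_mul_spectralOperator' hρ hτ z
  simp only [spectralOperator_one, Matrix.conjTranspose_one, one_mul, mul_one] at h2 h3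
  simp only [quadCost, mul_add, mul_one, Matrix.trace_add, Complex.add_re, Matrix.mul_smul,
    Matrix.trace_smul, Complex.smul_re, smul_eq_mul]
  rw [h1, h2, h3, h4, h5]
  simp only [Finset.mul_sum, ← Finset.sum_add_distrib]
  refine Finset.sum_congr rfl fun k _ => Finset.sum_congr rfl fun j _ => ?_
  ring

/-- If `τ` dominates `ρ`, eigenvectors of `ρ` with nonzero eigenvalue are orthogonal to the kernel
of `τ`. -/
lemma overlap_eq_zero (hd : Dominated ρ τ) {k j : n} (hk : hτ.eigenvalues k = 0)
    (hj : hρ.eigenvalues j ≠ 0) : overlap hρ hτ k j = 0 := by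
  -- The matrix unit isolates column `k` of the unitary, a kernel vector of `τ`.
  have h1 : τ * ((hτ.eigenvectorUnitary : Matrix n n ℂ) * Matrix.single k k 1) = 0 := by
    refine (congrArg (· * ((hτ.eigenvectorUnitary : Matrix n n ℂ) * Matrix.single k k 1))
      (eq_conj_diagonal hτ)).trans ?_
    rw [mul_assoc, ← mul_assoc _ (hτ.eigenvectorUnitary : Matrix n n ℂ),
      eigenvectorUnitary_conjTranspose_mul_self, one_mul, mul_assoc]
    convert mul_zero (hτ.eigenvectorUnitary : Matrix n n ℂ) using 2
    ext a b
    simp only [Matrix.diagonal_mul, Matrix.single_apply, Matrix.zero_apply]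
    split_ifs with h
    · rw [← h.1, hk]; simp
    · simp
  have h2 : ρ * ((hτ.eigenvectorUnitary : Matrix n n ℂ) * Matrix.single k k 1) = 0 := by
    ext a b
    have := hd (fun c => ((hτ.eigenvectorUnitary : Matrix n n ℂ) * Matrix.single k k 1 : Matrix n n ℂ) c b)
      (by funext c; exact congrFun (congrFun h1 c) b)
    exact congrFun this a
  have h3 : Matrix.diagonal (fun i => ((hρ.eigenvalues i : ℝ) : ℂ)) *
      ((overlap hρ hτ)ᴴ * Matrix.single k k 1) = 0 := by
    have h4 := congrArg (fun M => (hρ.eigenvectorUnitary : Matrix n n ℂ)ᴴ * M) h2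
    simp only [mul_zero] at h4
    rw [← h4]
    refine Eq.trans ?_ (congrArg (fun M => (hρ.eigenvectorUnitary : Matrix n n ℂ)ᴴ *
      (M * ((hτ.eigenvectorUnitary : Matrix n n ℂ) * Matrix.single k k 1)))
      (eq_conj_diagonal hρ)).symm
    simp only [← mul_assoc]
    rw [eigenvectorUnitary_conjTranspose_mul_self, one_mul, overlap, Matrix.conjTranspose_mul,
      Matrix.conjTranspose_conjTranspose]
    simp only [mul_assoc]
  have h5 := congrFun (congrFun h3 j) k
  rw [Matrix.diagonal_mul, Matrix.mul_single_apply_same, Matrix.zero_apply] at h5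
  simpa [hj] using h5

end Spectral

/-- The Gauss–Radau bound on `λ ^ α * μ ^ (1 - α)`. -/
lemma rpow_mul_rpow_le {α : ℝ} {m : ℕ} {t w : Fin m → ℝ}
    (h : ∀ x : ℝ, 0 < x → x ^ (α - 1) ≤ 1 + ∑ i, w i * ((x - 1) / (t i + (1 - t i) * x)))
    {l u : ℝ} (hl : 0 < l) (hu : 0 < u) :
    l ^ α * u ^ (1 - α) ≤ l + ∑ i, w i * (l * (l - u) / ((1 - t i) * l + t i * u)) := by
  have h1 := mul_le_mul_of_nonneg_left (h (l / u) (div_pos hl hu)) hl.le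
  have h2 : l * (l / u) ^ (α - 1) = l ^ α * u ^ (1 - α) := by
    rw [Real.div_rpow hl.le hu.le, ← neg_sub α 1, Real.rpow_neg hu.le, Real.rpow_sub_one hl.ne']
    field_simp
  rw [h2, mul_add, mul_one, Finset.mul_sum] at h1
  refine h1.trans_eq ?_
  congr 1
  refine Finset.sum_congr rfl fun i _ => ?_
  have h3 : (l / u - 1) / (t i + (1 - t i) * (l / u)) = (l - u) / ((1 - t i) * l + t i * u) := by
    rw [← mul_div_mul_right _ _ hu.ne']
    congr 1 <;> field_simp
    ring
  rw [h3]
  ring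

/-- The Gauss–Radau bound on `Tr[ρ ^ α τ ^ (1 - α)]`, attained by suitable operators `Z`. -/
theorem exists_petzTrace_le {α κ : ℝ} (hα : 1 < α) (hκ : κ < 0) {m : ℕ} {t w : Fin m → ℝ}
    (ht : ∀ i, 0 < t i ∧ t i ≤ 1)
    (h : ∀ x : ℝ, 0 < x → x ^ (α - 1) ≤ 1 + ∑ i, w i * ((x - 1) / (t i + (1 - t i) * x)))
    {ρ τ : Matrix n n ℂ} (hρ : ρ.PosSemidef) (hτ : τ.PosSemidef) (hd : Dominated ρ τ) :
    ∃ Z : Fin m → Matrix n n ℂ,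
      petzTrace α ρ τ ≤ ρ.trace.re + κ * ∑ i, w i / (-κ) / t i * quadCost (t i) ρ τ (Z i) := by
  -- The minimizer over real `z` of `λ (1 + 2 z + (1 - t) z ^ 2) + t μ z ^ 2`.
  let z : Fin m → n → n → ℝ := fun i k j =>
    -hρ.1.eigenvalues j / ((1 - t i) * hρ.1.eigenvalues j + t i * hτ.1.eigenvalues k)
  refine ⟨fun i => spectralOperator hρ.1 hτ.1 (z i), ?_⟩
  simp only [quadCost_spectralOperator]
  rw [petzTrace_eq_sum hρ.1 hτ.1, trace_eq_sum hρ.1 hτ.1]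
  simp only [Finset.mul_sum]
  rw [Finset.sum_comm (γ := Fin m), ← Finset.sum_add_distrib]
  refine Finset.sum_le_sum fun k _ => ?_
  rw [Finset.sum_comm (γ := Fin m), ← Finset.sum_add_distrib]
  refine Finset.sum_le_sum fun j _ => ?_
  have hl := hρ.eigenvalues_nonneg j
  have hu := hτ.eigenvalues_nonneg k
  simp only [z]
  by_cases hov : overlap hρ.1 hτ.1 k j = 0
  · simp [hov]
  rcases hl.eq_or_lt with hl0 | hl0
  · simp [← hl0, Real.zero_rpow (by linarith : α ≠ 0)]
  rcases hu.eq_or_lt with hu0 | hu0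
  -- Domination excludes the only singular case, `μ = 0 < λ` with nonzero overlap.
  · exact absurd (overlap_eq_zero hρ.1 hτ.1 hd hu0.symm hl0.ne') hov
  refine (mul_le_mul_of_nonneg_left (rpow_mul_rpow_le h hl0 hu0)
    (Complex.normSq_nonneg _)).trans_eq ?_
  rw [mul_add, Finset.mul_sum]
  congr 1
  refine Finset.sum_congr rfl fun i _ => ?_
  have h1 := (ht i).1
  have h2 := (ht i).2
  have h3 : (1 - t i) * hρ.1.eigenvalues j + t i * hτ.1.eigenvalues k ≠ 0 :=
    (add_pos_of_nonneg_of_pos (mul_nonneg (sub_nonneg.2 h2) hl) (mul_pos h1 hu0)).ne'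
  generalize hρ.1.eigenvalues j = l at *
  generalize hτ.1.eigenvalues k = u at *
  -- The minimal value carries a factor `t i`, cancelling the `1 / t i`; the prefactor `κ` and the
  -- `-κ` in the weights turn `u - l` into `l - u`.
  have h4 : l * (1 + 2 * (-l / ((1 - t i) * l + t i * u)) + (1 - t i) *
      (-l / ((1 - t i) * l + t i * u)) ^ 2) + t i * u * (-l / ((1 - t i) * l + t i * u)) ^ 2 =
      t i * (l * (u - l) / ((1 - t i) * l + t i * u)) := by
    generalize hD : (1 - t i) * l + t i * u = D at *
    field_simp
    rw [← hD]
    ring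
  rw [h4]
  generalize (1 - t i) * l + t i * u = D at *
  have hκ0 := hκ.ne
  field_simp
  ring

end Variational

/-! ### Partial traces and positivity -/

section PartialTrace

variable {m n : Type*} [Fintype m] [Fintype n] [DecidableEq m] [DecidableEq n]

lemma trace_traceLeft (R : Matrix (m × n) (m × n) ℂ) : (traceLeft R).trace = R.trace := by
  simp only [Matrix.trace, Matrix.diag, traceLeft, Fintype.sum_prod_type]
  exact Finset.sum_comm

lemma traceLeft_sum {ι : Type*} (s : Finset ι) (R : ι → Matrix (m × n) (m × n) ℂ) :
    traceLeft (∑ i ∈ s, R i) = ∑ i ∈ s, traceLeft (R i) := by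
  ext k l
  simp only [traceLeft, Matrix.sum_apply]
  exact Finset.sum_comm

lemma traceLeft_smul (c : ℂ) (R : Matrix (m × n) (m × n) ℂ) :
    traceLeft (c • R) = c • traceLeft R := by
  ext k l
  simp [traceLeft, Finset.mul_sum]

lemma traceLeft_eq_sum_partialState (R : Matrix (m × n) (m × n) ℂ) :
    traceLeft R = ∑ k, partialState R k := by
  ext i j
  simp [traceLeft, partialState, Matrix.sum_apply]

lemma traceLeft_kronecker (A : Matrix m m ℂ) (B : Matrix n n ℂ) :
    traceLeft (A ⊗ₖ B) = A.trace • B := by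
  ext k l
  simp [traceLeft, Matrix.trace, Finset.sum_mul]

lemma posSemidef_traceLeft {R : Matrix (m × n) (m × n) ℂ} (hR : R.PosSemidef) :
    (traceLeft R).PosSemidef := by
  rw [traceLeft_eq_sum_partialState]
  exact Matrix.posSemidef_sum _ fun k _ => hR.submatrix fun i => (k, i)

lemma trace_traceLeft_mul (R : Matrix (m × n) (m × n) ℂ) (B : Matrix n n ℂ) :
    (traceLeft R * B).trace = (R * ((1 : Matrix m m ℂ) ⊗ₖ B)).trace := by
  rw [← trace_traceLeft (R * _)]
  congr 1
  ext i j
  simp only [traceLeft, Matrix.mul_apply, Fintype.sum_prod_type, Matrix.kronecker_apply,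
    Matrix.one_apply, Finset.sum_mul]
  rw [Finset.sum_comm]
  refine Finset.sum_congr rfl fun k _ => ?_
  rw [Finset.sum_eq_single k (fun b _ hb => by simp [hb]) (by simp)]
  simp

lemma traceLeft_mul_kronecker_one_comm (A : Matrix m m ℂ) (R : Matrix (m × n) (m × n) ℂ) :
    traceLeft ((A ⊗ₖ (1 : Matrix n n ℂ)) * R) = traceLeft (R * (A ⊗ₖ (1 : Matrix n n ℂ))) := by
  ext i j
  simp only [traceLeft, Matrix.mul_apply, Fintype.sum_prod_type, Matrix.kronecker_apply,
    Matrix.one_apply, mul_ite, mul_one, mul_zero, ite_mul, zero_mul, Finset.sum_ite_eq,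
    Finset.sum_ite_eq', Finset.mem_univ, if_true]
  rw [Finset.sum_comm]
  exact Finset.sum_congr rfl fun k _ => Finset.sum_congr rfl fun l _ => mul_comm _ _

/-- Factor `A = Cᴴ * C` and move `Cᴴ` around by cyclicity in the traced-out factor; what remains is
a congruence of `R`. -/
lemma posSemidef_traceLeft_kronecker_one_mul {A : Matrix m m ℂ} (hA : A.PosSemidef)
    {R : Matrix (m × n) (m × n) ℂ} (hR : R.PosSemidef) :
    (traceLeft ((A ⊗ₖ (1 : Matrix n n ℂ)) * R)).PosSemidef := by
  obtain ⟨C, rfl⟩ := exists_eq_conjTranspose_mul_self hA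
  have h : ((Cᴴ * C) ⊗ₖ (1 : Matrix n n ℂ)) =
      (C ⊗ₖ (1 : Matrix n n ℂ))ᴴ * (C ⊗ₖ (1 : Matrix n n ℂ)) := by
    rw [Matrix.conjTranspose_kronecker, ← Matrix.mul_kronecker_mul, Matrix.conjTranspose_one,
      one_mul]
  have h2 : (C ⊗ₖ (1 : Matrix n n ℂ))ᴴ = Cᴴ ⊗ₖ (1 : Matrix n n ℂ) := by
    rw [Matrix.conjTranspose_kronecker, Matrix.conjTranspose_one]
  rw [h, mul_assoc, h2, traceLeft_mul_kronecker_one_comm, ← h2]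
  exact posSemidef_traceLeft (hR.mul_mul_conjTranspose_same _)

lemma ketbra_apply (k i j : m) : ketbra k i j = if k = i ∧ k = j then 1 else 0 :=
  Matrix.single_apply ..

lemma trace_ketbra (k : m) : (ketbra k).trace = 1 := by
  simp [ketbra]

lemma dominated_directSum {A B : m → Matrix n n ℂ} (h : ∀ i, Dominated (A i) (B i)) :
    Dominated (directSum A) (directSum B) := by
  intro v hv
  funext ⟨i, k⟩
  rw [directSum_mulVec]
  refine congrFun (h i _ ?_) k
  funext l
  rw [← directSum_mulVec, hv]
  rfl

lemma petzTrace_zero_left {α : ℝ} (hα : α ≠ 0) (B : Matrix n n ℂ) : petzTrace α 0 B = 0 := by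
  have h := mpow_smul (Matrix.PosSemidef.zero (n := n) (R := ℂ)) le_rfl α
  rw [smul_zero, Real.zero_rpow hα, zero_smul] at h
  rw [petzTrace, h, zero_mul, Matrix.trace_zero, Complex.zero_re]

end PartialTrace

/-! ### Block structure of the output of a round -/

namespace Devices

variable {𝒳 𝒴 𝒜 ℬ 𝒞 : Type*} [Fintype 𝒳] [Fintype 𝒴] [Fintype 𝒜] [Fintype ℬ] [Fintype 𝒞]
  [DecidableEq 𝒳] [DecidableEq 𝒴] [DecidableEq 𝒜] [DecidableEq 𝒞]
  {p : Protocol 𝒳 𝒴 𝒜 ℬ 𝒞}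
  {qA qB e : Type*} [Fintype qA] [Fintype qB] [Fintype e]
  [DecidableEq qA] [DecidableEq qB] [DecidableEq e]
  (d : Devices p qA qB) (σ : Matrix (qA × qB × e) (qA × qB × e) ℂ)

/-- Eve's unnormalized state given Alice's input `x` and output `a`. -/
noncomputable def eveState (x : 𝒳) (a : 𝒜) : Matrix e e ℂ :=
  if a ∈ p.outA x then
    traceLeft (traceLeft ((d.M x a ⊗ₖ ((1 : Matrix qB qB ℂ) ⊗ₖ (1 : Matrix e e ℂ))) * σ))
  else 0

lemma eveState_of_mem {x : 𝒳} {a : 𝒜} (ha : a ∈ p.outA x) : d.eveState σ x a =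
    traceLeft (traceLeft ((d.M x a ⊗ₖ ((1 : Matrix qB qB ℂ) ⊗ₖ (1 : Matrix e e ℂ))) * σ)) :=
  if_pos ha

lemma eveState_of_notMem {x : 𝒳} {a : 𝒜} (ha : a ∉ p.outA x) : d.eveState σ x a = 0 :=
  if_neg ha

lemma sum_kronecker {ι m n : Type*} (s : Finset ι) (A : ι → Matrix m m ℂ) (B : Matrix n n ℂ) :
    (∑ i ∈ s, A i) ⊗ₖ B = ∑ i ∈ s, A i ⊗ₖ B := by
  ext i j
  simp [Matrix.sum_apply, Finset.sum_mul]

lemma kronecker_sum {ι m n : Type*} (s : Finset ι) (A : Matrix m m ℂ) (B : ι → Matrix n n ℂ) :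
    A ⊗ₖ (∑ i ∈ s, B i) = ∑ i ∈ s, A ⊗ₖ B i := by
  ext i j
  simp [Matrix.sum_apply, Finset.mul_sum]

/-- No-signalling: by completeness of Alice's POVM, Eve's marginal does not depend on `x`. -/
lemma sum_eveState (x : 𝒳) : ∑ a, d.eveState σ x a = traceLeft (traceLeft σ) := by
  simp only [eveState]
  rw [Finset.sum_ite_mem, Finset.univ_inter, ← traceLeft_sum, ← traceLeft_sum, ← Finset.sum_mul,
    ← sum_kronecker, d.M_sum, Matrix.one_kronecker_one, Matrix.one_kronecker_one, one_mul]

lemma posSemidef_eveState (hσ : IsState σ) (x : 𝒳) (a : 𝒜) : (d.eveState σ x a).PosSemidef := by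
  by_cases ha : a ∈ p.outA x
  · rw [eveState_of_mem d σ ha, Matrix.one_kronecker_one]
    exact posSemidef_traceLeft (posSemidef_traceLeft_kronecker_one_mul (d.M_pos x a ha) hσ.1)
  · rw [eveState_of_notMem d σ ha]
    exact Matrix.PosSemidef.zero

lemma sum_bob_outcomes (x : 𝒳) (y : 𝒴) (a : 𝒜) :
    ∑ b ∈ p.outB y, traceLeft (traceLeft ((d.M x a ⊗ₖ (d.N y b ⊗ₖ (1 : Matrix e e ℂ))) * σ)) =
      traceLeft (traceLeft ((d.M x a ⊗ₖ ((1 : Matrix qB qB ℂ) ⊗ₖ (1 : Matrix e e ℂ))) * σ)) := by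
  rw [← traceLeft_sum, ← traceLeft_sum, ← Finset.sum_mul, ← kronecker_sum, ← sum_kronecker,
    d.N_sum]

lemma sum_ketbra_eveState (x : 𝒳) :
    ∑ a ∈ p.outA x, ketbra a ⊗ₖ traceLeft (traceLeft
      ((d.M x a ⊗ₖ ((1 : Matrix qB qB ℂ) ⊗ₖ (1 : Matrix e e ℂ))) * σ)) =
      directSum (d.eveState σ x) := by
  ext ⟨a, k⟩ ⟨a', l⟩
  simp only [Matrix.sum_apply, Matrix.kronecker_apply, ketbra_apply, directSum]
  split_ifs with h
  · subst h
    simp only [and_self, ite_mul, one_mul, zero_mul, Finset.sum_ite_eq', eveState]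
    split_ifs <;> simp
  · refine Finset.sum_eq_zero fun b _ => ?_
    rw [if_neg, zero_mul]
    rintro ⟨rfl, rfl⟩
    exact h rfl

lemma stateAE_eq_directSum (x : 𝒳) : d.stateAE σ x = directSum (d.eveState σ x) :=
  sum_ketbra_eveState d σ x

/-- Once the test data are discarded, Bob's outcome is recorded nowhere, and completeness of his
POVM removes it. -/
lemma traceLeft_roundOutput (x : 𝒳) (y : 𝒴) (t : Fin 2) :
    traceLeft (d.roundOutput σ x y t) = directSum (d.eveState σ x) := by
  rw [roundOutput, traceLeft_sum, ← sum_ketbra_eveState]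
  refine Finset.sum_congr rfl fun a _ => ?_
  rw [traceLeft_sum]
  simp only [traceLeft_kronecker, trace_ketbra, one_smul]
  rw [← kronecker_sum, sum_bob_outcomes]

/-- The marginal on `A X E` of the part of the output with test bit `t`. -/
lemma traceLeft_partialState_output (t : Fin 2) :
    traceLeft (traceLeft (partialState (d.output σ) t)) =
      directSum fun a => directSum fun x => (∑ y, p.P x y t) • d.eveState σ x a := by
  ext ⟨a, x, i⟩ ⟨a', x', j⟩
  have hout : ∀ c y, d.output σ (t, y, c, a, x, i) (t, y, c, a', x', j) =
      if x = x' then (p.P x y t : ℂ) * d.roundOutput σ x y t (c, a, i) (c, a', j) else 0 := by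
    intro c y
    simp only [output, ketbra_apply, and_self]
    rw [Finset.sum_eq_single x, Finset.sum_eq_single y, Finset.sum_eq_single t]
    · by_cases h : x = x' <;> simp [h]
    · intro b _ hb; simp [hb]
    · simp
    · intro b _ hb; simp [hb]
    · simp
    · intro b _ hb; simp [hb]
    · simp
  have hround : ∀ y, ∑ c, d.roundOutput σ x y t (c, a, i) (c, a', j) =
      directSum (d.eveState σ x) (a, i) (a', j) := by
    intro y
    rw [← traceLeft_roundOutput d σ x y t]
    rfl
  simp only [traceLeft, partialState, hout]
  rw [Finset.sum_comm]
  by_cases hx : x = x'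
  · subst hx
    simp only [if_true, ← Finset.mul_sum, hround, ← Finset.sum_mul]
    by_cases ha : a = a'
    · simp [directSum, ha]
    · simp [directSum, ha]
  · simp [directSum, hx]

lemma trace_eveStates (hσ : IsState σ) (x : 𝒳) : ∑ a, (d.eveState σ x a).trace = 1 := by
  rw [← Matrix.trace_sum, sum_eveState, trace_traceLeft, trace_traceLeft, hσ.2]

lemma trace_partialState_output (hσ : IsState σ) (t : Fin 2) :
    (partialState (d.output σ) t).trace = ((∑ x, ∑ y, p.P x y t : ℝ) : ℂ) := by
  rw [← trace_traceLeft, ← trace_traceLeft, traceLeft_partialState_output]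
  simp only [trace_directSum, Matrix.trace_smul]
  rw [Finset.sum_comm]
  simp only [← Finset.smul_sum, trace_eveStates d σ hσ]
  simp

lemma sum_sum_P : ∑ t, ∑ x, ∑ y, p.P x y t = 1 := by
  rw [← p.P_sum, Finset.sum_comm]
  exact Finset.sum_congr rfl fun x _ => Finset.sum_comm

lemma trace_output (hσ : IsState σ) : (d.output σ).trace = 1 := by
  rw [← trace_traceLeft, traceLeft_eq_sum_partialState, Matrix.trace_sum]
  simp only [trace_partialState_output d σ hσ]
  rw [← Complex.ofReal_sum, sum_sum_P, Complex.ofReal_one]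

lemma stateE_eq : d.stateE σ = traceLeft (traceLeft σ) := by
  rw [stateE, traceLeft_eq_sum_partialState (d.output σ)]
  simp only [traceLeft_sum, traceLeft_partialState_output, traceLeft_directSum]
  have h : ∀ t : Fin 2, ∑ a, ∑ x, (∑ y, p.P x y t) • d.eveState σ x a =
      (∑ x, ∑ y, p.P x y t) • traceLeft (traceLeft σ) := by
    intro t
    rw [Finset.sum_comm, Finset.sum_smul]
    exact Finset.sum_congr rfl fun x _ => by rw [← Finset.smul_sum, sum_eveState]
  simp only [h]
  rw [← Finset.sum_smul, sum_sum_P, one_smul]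

/-- The output has trace one, so conditioning divides by `P(T = 0)`. If that probability is zero,
both sides vanish by the convention for division by zero. -/
lemma keyState_eq (hσ : IsState σ) :
    d.keyState σ = directSum fun a => directSum fun x => p.probXKey x • d.eveState σ x a := by
  rw [keyState, conditionalState, traceLeft_smul, traceLeft_smul, traceLeft_partialState_output,
    trace_output d σ hσ, trace_partialState_output d σ hσ]
  ext ⟨a, x, i⟩ ⟨a', x', j⟩
  simp only [Matrix.smul_apply, directSum]
  split_ifs
  · simp only [Protocol.probXKey, Protocol.probKey, Complex.real_smul,
      smul_eq_mul]
    push_cast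
    ring
  · simp
  · simp

lemma traceLeft_keyState (hσ : IsState σ) :
    traceLeft (d.keyState σ) = directSum fun x => p.probXKey x • d.stateE σ := by
  rw [keyState_eq d σ hσ, traceLeft_directSum, stateE_eq, sum_directSum]
  simp only [← Finset.smul_sum, sum_eveState]

lemma posSemidef_stateE (hσ : IsState σ) : (d.stateE σ).PosSemidef := by
  rw [stateE_eq]
  exact posSemidef_traceLeft (posSemidef_traceLeft hσ.1)

lemma keyTrace_eq_sum (hσ : IsState σ) (α : ℝ) (x : 𝒳) :
    d.keyTrace σ α x = ∑ a, petzTrace α (d.eveState σ x a) (d.stateE σ) := by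
  rw [keyTrace, stateAE_eq_directSum, mpow_directSum (d.posSemidef_eveState σ hσ x),
    one_kronecker_eq_directSum, directSum_mul, trace_directSum, Complex.re_sum]
  rfl

end Devices

namespace Protocol

variable {𝒳 𝒴 𝒜 ℬ 𝒞 : Type*} [Fintype 𝒳] [Fintype 𝒴] (p : Protocol 𝒳 𝒴 𝒜 ℬ 𝒞)

lemma probXKey_nonneg (x : 𝒳) : 0 ≤ p.probXKey x :=
  div_nonneg (Finset.sum_nonneg fun y _ => p.P_nonneg x y 0)
    (Finset.sum_nonneg fun x _ => Finset.sum_nonneg fun y _ => p.P_nonneg x y 0)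

lemma probXKey_eq_zero {x : 𝒳} (hx : x ∉ p.keyX) : p.probXKey x = 0 := by
  have : ∑ y, p.P x y 0 = 0 := Finset.sum_eq_zero fun y _ => by
    by_contra h
    exact hx (p.P_key x y h).1
  rw [probXKey, this, zero_div]

lemma sum_probXKey (h : 0 < p.probKey) : ∑ x, p.probXKey x = 1 := by
  simp only [probXKey]
  rw [← Finset.sum_div]
  exact div_self h.ne'

end Protocol

/-! ### The entropy formula and the variational bound -/

namespace Devices

variable {𝒳 𝒴 𝒜 ℬ 𝒞 : Type*} [Fintype 𝒳] [Fintype 𝒴] [Fintype 𝒜] [Fintype ℬ] [Fintype 𝒞]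
  [DecidableEq 𝒳] [DecidableEq 𝒴] [DecidableEq 𝒜] [DecidableEq 𝒞]
  {p : Protocol 𝒳 𝒴 𝒜 ℬ 𝒞}
  {qA qB e : Type*} [Fintype qA] [Fintype qB] [Fintype e]
  [DecidableEq qA] [DecidableEq qB] [DecidableEq e]
  (d : Devices p qA qB) (σ : Matrix (qA × qB × e) (qA × qB × e) ℂ)

theorem keyEntropy_eq {α : ℝ} (hα : 1 < α) (hσ : IsState σ) (hp : 0 < p.probKey) :
    d.keyEntropy σ α = ((1 / (1 - α) *
      Real.logb 2 (∑ x ∈ p.keyX, p.probXKey x * d.keyTrace σ α x) : ℝ) : EReal) := by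
  have hpos : ∀ a x, (p.probXKey x • d.eveState σ x a).PosSemidef := fun a x =>
    (d.posSemidef_eveState σ hσ x a).smul (p.probXKey_nonneg x)
  have hposE : ∀ x, (p.probXKey x • d.stateE σ).PosSemidef := fun x =>
    (d.posSemidef_stateE σ hσ).smul (p.probXKey_nonneg x)
  have hdom : Dominated (d.keyState σ) ((1 : Matrix 𝒜 𝒜 ℂ) ⊗ₖ traceLeft (d.keyState σ)) := by
    rw [one_kronecker_eq_directSum, keyState_eq d σ hσ, traceLeft_directSum]
    exact dominated_directSum fun a =>
      dominated_sum (fun b => posSemidef_directSum (hpos b)) a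
  have htr : (d.keyState σ).trace.re = 1 := by
    rw [keyState_eq d σ hσ]
    simp only [trace_directSum, Matrix.trace_smul]
    rw [Finset.sum_comm]
    simp only [← Finset.smul_sum, trace_eveStates d σ hσ]
    rw [← Finset.sum_smul, p.sum_probXKey hp, one_smul, Complex.one_re]
  have hpetz : petzTrace α (d.keyState σ) ((1 : Matrix 𝒜 𝒜 ℂ) ⊗ₖ traceLeft (d.keyState σ)) =
      ∑ x ∈ p.keyX, p.probXKey x * d.keyTrace σ α x := by
    rw [traceLeft_keyState d σ hσ, one_kronecker_eq_directSum, keyState_eq d σ hσ,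
      petzTrace_directSum (fun a => posSemidef_directSum (hpos a))
        (fun _ => posSemidef_directSum hposE)]
    simp only [petzTrace_directSum (hpos _) hposE, petzTrace_smul_smul
      (d.posSemidef_eveState σ hσ _ _) (d.posSemidef_stateE σ hσ) hα (p.probXKey_nonneg _)]
    rw [Finset.sum_comm]
    simp only [← Finset.mul_sum, ← keyTrace_eq_sum d σ hσ]
    refine (Finset.sum_subset (Finset.subset_univ _) fun x _ hx => ?_).symm
    rw [p.probXKey_eq_zero hx, zero_mul]
  rw [keyEntropy, petzCondEntropy, petzDivergence, if_pos (Or.inr hdom), hpetz, htr, div_one,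
    ← EReal.coe_neg, ← neg_mul, ← neg_sub α 1, one_div, one_div, inv_neg]

lemma trace_mul_kronecker (A : Matrix qA qA ℂ) (B : Matrix e e ℂ) :
    (σ * (A ⊗ₖ ((1 : Matrix qB qB ℂ) ⊗ₖ B))).trace =
      (traceLeft (traceLeft ((A ⊗ₖ ((1 : Matrix qB qB ℂ) ⊗ₖ (1 : Matrix e e ℂ))) * σ)) *
        B).trace := by
  rw [trace_traceLeft_mul, trace_traceLeft_mul, mul_assoc,
    Matrix.trace_mul_comm (A ⊗ₖ ((1 : Matrix qB qB ℂ) ⊗ₖ (1 : Matrix e e ℂ))), mul_assoc,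
    ← Matrix.mul_kronecker_mul, ← Matrix.mul_kronecker_mul, one_mul, one_mul, mul_one]

/-- Both terms of the objective see only Eve's operators: tracing out the devices turns the `P` term
into a trace against `eveState` and the `Q` term into one against `stateE`. -/
lemma objective_eq_sum {α : ℝ} {m : ℕ} {t : Fin m → ℝ} (ht : ∀ i, 0 < t i) (w : Fin m → ℝ)
    (x : 𝒳) (Z : 𝒜 → Fin m → Matrix e e ℂ) :
    d.objective σ α t w x Z = ∑ a ∈ p.outA x, ((d.eveState σ x a).trace.re +
      Real.sin (α * Real.pi) / Real.pi *
        ∑ i, w i / t i * quadCost (t i) (d.eveState σ x a) (d.stateE σ) (Z a i)) := by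
  rw [objective]
  refine Finset.sum_congr rfl fun a ha => ?_
  rw [← trace_polyP_add_trace_polyQ α ht, mul_add, Matrix.trace_add, Complex.add_re,
    trace_mul_kronecker, trace_mul_kronecker, eveState_of_mem d σ ha, stateE_eq,
    Matrix.one_kronecker_one, Matrix.one_kronecker_one, one_mul]

lemma posSemidef_stateE_sub_eveState (hσ : IsState σ) (x : 𝒳) (a : 𝒜) :
    (d.stateE σ - d.eveState σ x a).PosSemidef := by
  rw [stateE_eq, ← sum_eveState d σ x, ← Finset.add_sum_erase _ _ (Finset.mem_univ a),
    add_sub_cancel_left]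
  exact Matrix.posSemidef_sum _ fun b _ => d.posSemidef_eveState σ hσ x b

/-- Each conditional state of Eve lies below her marginal, so `quadCost_ge` applies, and the
nonpositive prefactor reverses its direction. Boundedness also keeps the real `⨆` from taking its
default value. -/
lemma bddAbove_objective {α : ℝ} (hα : Real.sin (α * Real.pi) / Real.pi ≤ 0) {m : ℕ}
    {t w : Fin m → ℝ} (ht : ∀ i, 0 < t i ∧ t i ≤ 1) (hw : ∀ i, 0 ≤ w i) (hσ : IsState σ) (x : 𝒳) :
    BddAbove (Set.range fun Z : 𝒜 → Fin m → Matrix e e ℂ => d.objective σ α t w x Z) := by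
  refine ⟨∑ a ∈ p.outA x, ((d.eveState σ x a).trace.re + Real.sin (α * Real.pi) / Real.pi *
    ∑ i, w i / t i * ((1 - 1 / t i) * (d.eveState σ x a).trace.re)), ?_⟩
  rintro _ ⟨Z, rfl⟩
  simp only [objective_eq_sum d σ (fun i => (ht i).1)]
  refine Finset.sum_le_sum fun a _ => ?_
  refine add_le_add le_rfl ?_
  refine mul_le_mul_of_nonpos_left (Finset.sum_le_sum fun i _ => ?_) hα
  exact mul_le_mul_of_nonneg_left (quadCost_ge (ht i).1 (ht i).2
    (d.posSemidef_eveState σ hσ x a) (d.posSemidef_stateE_sub_eveState σ hσ x a) _)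
    (div_nonneg (hw i) (ht i).1.le)

lemma exists_keyTrace_le_objective {α : ℝ} (hα : 1 < α)
    (hκ : Real.sin (α * Real.pi) / Real.pi < 0) {m : ℕ} {t w : Fin m → ℝ}
    (ht : ∀ i, 0 < t i ∧ t i ≤ 1)
    (h : ∀ x : ℝ, 0 < x → x ^ (α - 1) ≤ 1 + ∑ i, w i * ((x - 1) / (t i + (1 - t i) * x)))
    (hσ : IsState σ) (x : 𝒳) :
    ∃ Z : 𝒜 → Fin m → Matrix e e ℂ, d.keyTrace σ α x ≤
      d.objective σ α t (fun i => w i / -(Real.sin (α * Real.pi) / Real.pi)) x Z := by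
  have hdom : ∀ a, Dominated (d.eveState σ x a) (d.stateE σ) := fun a => by
    rw [stateE_eq, ← sum_eveState d σ x]
    exact dominated_sum (d.posSemidef_eveState σ hσ x) a
  choose Z hZ using fun a => exists_petzTrace_le hα hκ ht h (d.posSemidef_eveState σ hσ x a)
    (d.posSemidef_stateE σ hσ) (hdom a)
  refine ⟨Z, ?_⟩
  rw [keyTrace_eq_sum d σ hσ, objective_eq_sum d σ (fun i => (ht i).1),
    -- Outcomes outside `p.outA x` have zero state and contribute nothing to the Petz trace.
    ← Finset.sum_subset (Finset.subset_univ (p.outA x)) fun a _ ha => by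
      rw [eveState_of_notMem d σ ha, petzTrace_zero_left (by linarith)]]
  exact Finset.sum_le_sum fun a _ => hZ a

end Devices

lemma sin_mul_pi_div_pi_neg {α : ℝ} (hα₁ : 1 < α) (hα₂ : α < 2) :
    Real.sin (α * Real.pi) / Real.pi < 0 := by
  refine div_neg_of_neg_of_pos ?_ Real.pi_pos
  have h := Real.sin_pos_of_pos_of_lt_pi (x := α * Real.pi - Real.pi)
    (by nlinarith [Real.pi_pos]) (by nlinarith [Real.pi_pos])
  rw [Real.sin_sub_pi] at h
  linarith

end DIRenyi

theorem proposition6 (α : ℝ) (hα₁ : 1 < α) (hα₂ : α < 2) :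
    (∀ (𝒳 𝒴 𝒜 ℬ 𝒞 qA qB e : Type*)
      [Fintype 𝒳] [Fintype 𝒴] [Fintype 𝒜] [Fintype ℬ] [Fintype 𝒞]
      [DecidableEq 𝒳] [DecidableEq 𝒴] [DecidableEq 𝒜] [DecidableEq 𝒞]
      [Fintype qA] [Fintype qB] [Fintype e] [DecidableEq qA] [DecidableEq qB] [DecidableEq e]
      (p : Protocol 𝒳 𝒴 𝒜 ℬ 𝒞) (d : Devices p qA qB)
      (σ : Matrix (qA × qB × e) (qA × qB × e) ℂ), IsState σ → 0 < p.probKey →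
        d.keyEntropy σ α =
          ((1 / (1 - α) *
            Real.logb 2 (∑ x ∈ p.keyX, p.probXKey x * d.keyTrace σ α x) : ℝ) : EReal)) ∧
    (∀ m : ℕ, 1 ≤ m → ∃ t w : Fin m → ℝ,
      (∀ i, 0 < t i ∧ t i ≤ 1) ∧ (∀ i, 0 < w i) ∧
      ∀ (𝒳 𝒴 𝒜 ℬ 𝒞 qA qB e : Type*)
        [Fintype 𝒳] [Fintype 𝒴] [Fintype 𝒜] [Fintype ℬ] [Fintype 𝒞]
        [DecidableEq 𝒳] [DecidableEq 𝒴] [DecidableEq 𝒜] [DecidableEq 𝒞]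
        [Fintype qA] [Fintype qB] [Fintype e] [DecidableEq qA] [DecidableEq qB] [DecidableEq e]
        (p : Protocol 𝒳 𝒴 𝒜 ℬ 𝒞) (d : Devices p qA qB)
        (σ : Matrix (qA × qB × e) (qA × qB × e) ℂ), IsState σ → ∀ x ∈ p.keyX,
          BddAbove (Set.range fun Z : 𝒜 → Fin m → Matrix e e ℂ => d.objective σ α t w x Z) ∧
          d.keyTrace σ α x ≤ ⨆ Z : 𝒜 → Fin m → Matrix e e ℂ, d.objective σ α t w x Z) := by
  refine ⟨fun 𝒳 𝒴 𝒜 ℬ 𝒞 qA qB e => ?_, fun m hm => ?_⟩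
  · intros
    exact Devices.keyEntropy_eq _ _ hα₁ ‹_› ‹_›
  · obtain ⟨t, w, -, ht, hw, h⟩ :=
      exists_rpow_le_gaussRadau (r := α - 1) ⟨by linarith, by linarith⟩ hm
    have hκ := sin_mul_pi_div_pi_neg hα₁ hα₂
    have hw' : ∀ i, 0 < w i / -(Real.sin (α * Real.pi) / Real.pi) := fun i =>
      div_pos (hw i) (neg_pos.2 hκ)
    -- The weights are the quadrature weights divided by `-sin (απ) / π`, fixed before any round is
    -- introduced.
    refine ⟨t, _, ht, hw', ?_⟩
    intro 𝒳 𝒴 𝒜 ℬ 𝒞 qA qB e _ _ _ _ _ _ _ _ _ _ _ _ _ _ _ p d σ hσ x _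
    have hbdd := d.bddAbove_objective σ hκ.le ht (fun i => (hw' i).le) hσ x
    obtain ⟨Z, hZ⟩ := d.exists_keyTrace_le_objective σ hα₁ hκ ht h hσ x
    exact ⟨hbdd, hZ.trans (le_ciSup hbdd Z)⟩
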